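/- Let $d\ge 3$ and $l\ge 1$ be fixed integers. For $n$ with $dn$ even, let $G$ be a uniformly random $d$-regular simple graph on $n$ labelled vertices, and let $u,v$ be vertices of $G$ chosen independently and uniformly at random. A geodesic between $u$ and $v$ is a shortest path between them. Write $\gamma(n,d)=\tfrac12\log_{d-1}n-\lfloor\tfrac12\log_{d-1}n\rfloor$ for the fractional part of $\tfrac12\log_{d-1}n$. Then the series below converges and, as $n\to\infty$ through integers with $dn$ even, $$\mathbb{P}\big(u,v\text{ are joined by exactly } l \text{ distinct geodesics}\big)\;\sim\;\sum_{k=-\infty}^{\infty}\frac{\big(d(d-1)^{2k-2\gamma(n,d)-2}\big)^l}{l!}\exp\!\Big(-\frac{d(d-1)^{2k-2\gamma(n,d)-1}}{d-2}\Big)\Big(1+(d-1)^l\exp\!\big(-d(d-1)^{2k-2\gamma(n,d)-1}\big)\Big),$$ that is, the ratio of the two sides tends to $1$. -/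

import Mathlib

open Filter Asymptotics

/-- A geodesic between `u` and `v` in `G`: a shortest path between `u` and `v`. For fixed ends, a path
seen as a walk from `u` to `v` is determined by its underlying subgraph. -/
def IsGeodesic {V : Type*} {G : SimpleGraph V} {u v : V} (p : G.Walk u v) : Prop :=
  p.IsPath ∧ ∀ q : G.Walk u v, q.IsPath → p.length ≤ q.length

/-- The number of distinct geodesics joining `u` and `v` in `G` (zero if `u` and `v` lie in different
components). -/
noncomputable def numGeodesics {V : Type*} (G : SimpleGraph V) (u v : V) : ℕ :=
  Set.ncard {p : G.Walk u v | IsGeodesic p}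

open Classical in
/-- The set of all `d`-regular simple graphs on the `n` labelled vertices `0, …, n - 1`. -/
def regularGraphs (n d : ℕ) : Set (SimpleGraph (Fin n)) :=
  {G | G.IsRegularOfDegree d}

/-- The probability of the event `A` when `G` is a uniformly random `d`-regular graph on `n` labelled
vertices and `u`, `v` are independent uniformly random vertices. The triple `(G, u, v)` is then
uniform on the finite product `regularGraphs n d × Fin n × Fin n`. -/
noncomputable def randomRegularProb (n d : ℕ) (A : SimpleGraph (Fin n) → Fin n → Fin n → Prop) : ℝ :=
  (Set.ncard {x : SimpleGraph (Fin n) × Fin n × Fin n |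
      x.1 ∈ regularGraphs n d ∧ A x.1 x.2.1 x.2.2} : ℝ) /
    ((Set.ncard (regularGraphs n d) : ℝ) * (n : ℝ) ^ 2)

/-- The fractional part of `(1/2) * log_{d-1} n`. -/
noncomputable def gammaFrac (n d : ℕ) : ℝ :=
  Int.fract ((1 / 2 : ℝ) * Real.logb ((d : ℝ) - 1) (n : ℝ))

/-- The `k`-th term of the limiting sum. -/
noncomputable def geodesicTerm (d l n : ℕ) (k : ℤ) : ℝ :=
  ((d : ℝ) * ((d : ℝ) - 1) ^ (2 * (k : ℝ) - 2 * gammaFrac n d - 2)) ^ l / (l.factorial : ℝ) *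
    Real.exp (-((d : ℝ) * ((d : ℝ) - 1) ^ (2 * (k : ℝ) - 2 * gammaFrac n d - 1) / ((d : ℝ) - 2))) *
    (1 + ((d : ℝ) - 1) ^ l *
      Real.exp (-((d : ℝ) * ((d : ℝ) - 1) ^ (2 * (k : ℝ) - 2 * gammaFrac n d - 1))))

/-! Write q = d - 1 and grow a ball of radius i about u and one of radius j about v, with q^i and
q^j of order √n. If the balls are disjoint and joined by exactly m ≥ 1 edges, then u and v are at
distance i + j + 1. Each joining edge then carries exactly one geodesic, unless one of its ends is
reached from its centre by several shortest walks. So the law of the number of joining edges is what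
matters.

That law comes from switchings. Replacing a joining edge ab and an edge xy elsewhere by ax and by
matches graphs with m + 1 joining edges against graphs with m (`sum_card_cutPairs`). There are about
(m + 1)(q + 1)n choices one way and (q + 1)^2 q^(i+j) the other way. Consecutive probabilities
therefore have ratio y/(m + 1) with y = (q + 1)q^(i+j)/n (`abs_linked_ratio_le`), which is Poisson
behaviour with mean y. A second switching (`sum_redundantDarts_mul_le`) shows that balls are nearly
trees: on average the darts leaving a ball fall short of (q + 1)q^i by O(1) only (`sum_deficit_le`).
This makes the error terms, including the exceptional geodesics of `prob_walkCount_ne_le`, tend to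
0.

Having no joining edge means that the balls of radii i + 1 and j are disjoint, so the Poisson law
also yields a recursion for disjointness. With j fixed and i at offset h, the mean is θ q^h with θ
bounded above and away from 0. The disjointness probability is multiplied by about exp(-θ q^h) at
each step, hence is about exp(-θ q^h/(q - 1)) (`tendsto_survival`). A length of mean y thus
contributes y^l/l! · exp(-qy/(q - 1)), and two consecutive lengths, of means y and qy, make one term
of the series (`geodesicTerm_eq`).

Lengths far from the typical one are negligible uniformly in n (`tendsto_sub_tsum`), so the
difference of the two sides tends to 0. The series stays above a positive constant
(`exists_pos_le_tsum`), so the ratio tends to 1. -/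

set_option linter.unusedSectionVars false

/-! ### Balls, boundary darts and walk counts in a regular graph -/

namespace RandomRegular
section
open Classical

variable {V : Type*} [Fintype V]

/-- Every vertex of `G` has exactly `d` neighbours. -/
def IsReg (G : SimpleGraph V) (d : ℕ) : Prop :=
  ∀ v, (Finset.univ.filter fun w => G.Adj v w).card = d

/-- The vertices at distance at most `r` from `u`. -/
noncomputable def ball (G : SimpleGraph V) (u : V) : ℕ → Finset V
  | 0 => {u}
  | r + 1 => ball G u r ∪ Finset.univ.filter fun x => ∃ w ∈ ball G u r, G.Adj w x

lemma mem_ball_zero {G : SimpleGraph V} {u x : V} : x ∈ ball G u 0 ↔ x = u := by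
  simp [ball]

lemma mem_ball_succ {G : SimpleGraph V} {u x : V} {r : ℕ} :
    x ∈ ball G u (r + 1) ↔ x ∈ ball G u r ∨ ∃ w ∈ ball G u r, G.Adj w x := by
  simp [ball]

lemma ball_subset_succ (G : SimpleGraph V) (u : V) (r : ℕ) : ball G u r ⊆ ball G u (r + 1) :=
  fun _ hx => mem_ball_succ.2 (Or.inl hx)

lemma ball_mono (G : SimpleGraph V) (u : V) {r s : ℕ} (h : r ≤ s) : ball G u r ⊆ ball G u s := by
  induction s, h using Nat.le_induction with
  | base => exact subset_rfl
  | succ s _ ih => exact ih.trans (ball_subset_succ G u s)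

lemma mem_ball_of_adj {G : SimpleGraph V} {u w x : V} {r : ℕ} (hw : w ∈ ball G u r)
    (h : G.Adj w x) : x ∈ ball G u (r + 1) :=
  mem_ball_succ.2 (Or.inr ⟨w, hw, h⟩)

lemma self_mem_ball (G : SimpleGraph V) (u : V) (r : ℕ) : u ∈ ball G u r :=
  ball_mono G u (Nat.zero_le r) (mem_ball_zero.2 rfl)

lemma mem_ball_iff_walk {G : SimpleGraph V} {u x : V} {r : ℕ} :
    x ∈ ball G u r ↔ ∃ p : G.Walk u x, p.length ≤ r := by
  induction r generalizing x with
  | zero =>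
    rw [mem_ball_zero]
    constructor
    · rintro rfl
      exact ⟨.nil, le_rfl⟩
    · rintro ⟨p, hp⟩
      exact (SimpleGraph.Walk.eq_of_length_eq_zero (Nat.le_zero.1 hp)).symm
  | succ r ih =>
    rw [mem_ball_succ]
    constructor
    · rintro (h | ⟨w, hw, hwx⟩)
      · obtain ⟨p, hp⟩ := ih.1 h
        exact ⟨p, by omega⟩
      · obtain ⟨p, hp⟩ := ih.1 hw
        exact ⟨p.concat hwx, by simpa using hp⟩
    · rintro ⟨p, hp⟩
      by_cases hr : p.length ≤ r
      · exact Or.inl (ih.2 ⟨p, hr⟩)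
      · right
        have hpr : p.reverse.length = r + 1 := by simp; omega
        cases hq : p.reverse with
        | nil => simp [hq] at hpr
        | cons h q =>
          refine ⟨_, ih.2 ⟨q.reverse, ?_⟩, h.symm⟩
          rw [hq] at hpr
          simp at hpr ⊢
          omega

lemma mem_ball_comm {G : SimpleGraph V} {u x : V} {r : ℕ} : x ∈ ball G u r ↔ u ∈ ball G x r := by
  simp only [mem_ball_iff_walk]
  exact ⟨fun ⟨p, hp⟩ => ⟨p.reverse, by simpa using hp⟩, fun ⟨p, hp⟩ => ⟨p.reverse, by simpa using hp⟩⟩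

lemma mem_ball_trans {G : SimpleGraph V} {u x y : V} {r s : ℕ} (h : x ∈ ball G u r)
    (h' : y ∈ ball G x s) : y ∈ ball G u (r + s) := by
  obtain ⟨p, hp⟩ := mem_ball_iff_walk.1 h
  obtain ⟨p', hp'⟩ := mem_ball_iff_walk.1 h'
  exact mem_ball_iff_walk.2 ⟨p.append p', by simp; omega⟩

/-- Only edges traversed while exploring up to radius i matter, so edges elsewhere may be deleted or
switched freely. -/
lemma ball_subset_of_adj {G G' : SimpleGraph V} {u : V} {i : ℕ}
    (h : ∀ r < i, ∀ w ∈ ball G u r, ∀ z ∈ ball G u (r + 1), G.Adj w z → G'.Adj w z) :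
    ball G u i ⊆ ball G' u i := by
  induction i with
  | zero => exact subset_rfl
  | succ i ih =>
    have ih' := ih fun r hr => h r (by omega)
    intro x hx
    have hx' := hx
    rw [mem_ball_succ] at hx ⊢
    rcases hx with hx | ⟨w, hw, hwx⟩
    · exact Or.inl (ih' hx)
    · exact Or.inr ⟨w, ih' hw, h i (by omega) w hw x hx' hwx⟩

lemma ball_mono_graph {G G' : SimpleGraph V} (h : G ≤ G') (u : V) (i : ℕ) :
    ball G u i ⊆ ball G' u i :=
  ball_subset_of_adj fun _ _ _ _ _ _ hadj => h hadj

lemma ball_congr {G G' : SimpleGraph V} {u : V} {i : ℕ}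
    (h : ∀ r < i, ∀ w ∈ ball G u r, ∀ z, G.Adj w z ↔ G'.Adj w z) {r : ℕ} (hr : r ≤ i) :
    ball G' u r = ball G u r := by
  induction r with
  | zero => rfl
  | succ r ih =>
    have ih' := ih (by omega)
    ext x
    simp only [mem_ball_succ, ih']
    refine or_congr_right ⟨?_, ?_⟩
    · rintro ⟨w, hw, hwx⟩
      exact ⟨w, hw, (h r (by omega) w hw x).2 hwx⟩
    · rintro ⟨w, hw, hwx⟩
      exact ⟨w, hw, (h r (by omega) w hw x).1 hwx⟩

/-- The darts leaving the ball of radius `r` around `u`. -/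
noncomputable def outDarts (G : SimpleGraph V) (u : V) (r : ℕ) : Finset (V × V) :=
  Finset.univ.filter fun p => p.1 ∈ ball G u r ∧ p.2 ∉ ball G u r ∧ G.Adj p.1 p.2

/-- The vertices at distance exactly `r + 1` from `u`. -/
noncomputable def shell (G : SimpleGraph V) (u : V) (r : ℕ) : Finset V :=
  ball G u (r + 1) \ ball G u r

/-- The darts `(a, b)` whose ends remain within distance `r` of `u` after deletion of the edge
`ab`. -/
noncomputable def redundantDarts (G : SimpleGraph V) (u : V) (r : ℕ) : Finset (V × V) :=
  Finset.univ.filter fun p => G.Adj p.1 p.2 ∧ p.1 ∈ ball (G.deleteEdges {s(p.1, p.2)}) u r ∧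
    p.2 ∈ ball (G.deleteEdges {s(p.1, p.2)}) u r

lemma mem_outDarts {G : SimpleGraph V} {u : V} {r : ℕ} {p : V × V} :
    p ∈ outDarts G u r ↔ p.1 ∈ ball G u r ∧ p.2 ∉ ball G u r ∧ G.Adj p.1 p.2 := by
  simp [outDarts]

lemma mem_shell {G : SimpleGraph V} {u x : V} {r : ℕ} :
    x ∈ shell G u r ↔ x ∉ ball G u r ∧ ∃ a ∈ ball G u r, G.Adj a x := by
  rw [shell, Finset.mem_sdiff, mem_ball_succ]
  tauto

lemma mem_redundantDarts {G : SimpleGraph V} {u : V} {r : ℕ} {p : V × V} :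
    p ∈ redundantDarts G u r ↔ G.Adj p.1 p.2 ∧ p.1 ∈ ball (G.deleteEdges {s(p.1, p.2)}) u r ∧
    p.2 ∈ ball (G.deleteEdges {s(p.1, p.2)}) u r := by
  simp [redundantDarts]

lemma not_mem_ball_of_adj {G : SimpleGraph V} {u a x : V} {r s : ℕ} (hx : x ∉ ball G u r)
    (h : G.Adj a x) (hs : s < r) : a ∉ ball G u s := fun ha =>
  hx (ball_mono G u hs (mem_ball_of_adj ha h))

/-- A walk of length at most r cannot use the edge ax: it never visits x, and it meets a at time r
at the earliest, with no step left. -/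
lemma mem_ball_deleteEdges {G : SimpleGraph V} {u a x w : V} {r : ℕ} (hx : x ∉ ball G u r)
    (h : G.Adj a x) (hw : w ∈ ball G u r) : w ∈ ball (G.deleteEdges {s(a, x)}) u r := by
  refine ball_subset_of_adj ?_ hw
  intro s hs y hy z hz hyz
  rw [SimpleGraph.deleteEdges_adj]
  refine ⟨hyz, ?_⟩
  rw [Set.mem_singleton_iff, Sym2.eq_iff]
  rintro (⟨rfl, rfl⟩ | ⟨rfl, rfl⟩)
  · exact not_mem_ball_of_adj hx h hs hy
  · exact hx (ball_mono G u hs.le hy)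

lemma adj_deleteEdges_of_ne {G : SimpleGraph V} {a b x : V} (h : G.Adj b x) (hab : b ≠ a)
    (hax : x ≠ a) {c : V} : (G.deleteEdges {s(a, c)}).Adj b x := by
  rw [SimpleGraph.deleteEdges_adj]
  refine ⟨h, ?_⟩
  rw [Set.mem_singleton_iff, Sym2.eq_iff]
  rintro (⟨rfl, rfl⟩ | ⟨rfl, rfl⟩)
  · exact hab rfl
  · exact hax rfl

lemma card_shell_darts {G : SimpleGraph V} {d : ℕ} (hG : IsReg G d) (S : Finset V) :
    (Finset.univ.filter fun p : V × V => p.1 ∈ S ∧ G.Adj p.1 p.2).card = d * S.card := by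
  rw [Finset.card_filter, Fintype.sum_prod_type]
  have h : ∀ a : V, (∑ b : V, if a ∈ S ∧ G.Adj a b then 1 else 0) = if a ∈ S then d else 0 := by
    intro a
    by_cases ha : a ∈ S
    · simp only [ha, true_and, if_true, ← Finset.card_filter, hG a]
    · simp [ha]
  rw [Finset.sum_congr rfl fun a _ => h a, ← Finset.sum_filter]
  simp [mul_comm]

/-- The exact dart count at a shell; the last summand counts darts inside the shell. -/
lemma card_outDarts_succ {G : SimpleGraph V} {d : ℕ} (hG : IsReg G d) (u : V) (r : ℕ) :
    (outDarts G u (r + 1)).card + (outDarts G u r).card +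
      (Finset.univ.filter fun p : V × V =>
        p.1 ∈ shell G u r ∧ p.2 ∈ shell G u r ∧ G.Adj p.1 p.2).card =
      d * (shell G u r).card := by
  rw [← card_shell_darts hG]
  have hsw : (outDarts G u r).card = (Finset.univ.filter fun p : V × V =>
      p.1 ∈ shell G u r ∧ p.2 ∈ ball G u r ∧ G.Adj p.1 p.2).card := by
    refine Finset.card_bij (fun p _ => p.swap) ?_ (fun _ _ _ _ h => Prod.swap_injective h) ?_
    · rintro ⟨a, x⟩ h
      simp only [mem_outDarts] at h
      simp only [Finset.mem_filter, Finset.mem_univ, true_and, Prod.fst_swap, Prod.snd_swap,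
        mem_shell]
      exact ⟨⟨h.2.1, a, h.1, h.2.2⟩, h.1, h.2.2.symm⟩
    · rintro ⟨x, a⟩ h
      simp only [Finset.mem_filter, Finset.mem_univ, true_and, mem_shell] at h
      exact ⟨(a, x), mem_outDarts.2 ⟨h.2.1, h.1.1, h.2.2.symm⟩, rfl⟩
  rw [hsw, ← Finset.card_union_of_disjoint, ← Finset.card_union_of_disjoint]
  · congr 1
    ext ⟨x, z⟩
    simp only [Finset.mem_union, mem_outDarts, Finset.mem_filter, Finset.mem_univ, true_and]
    constructor
    · rintro ((⟨h1, h2, h3⟩ | ⟨h1, h2, h3⟩) | ⟨h1, h2, h3⟩)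
      · refine ⟨Finset.mem_sdiff.2 ⟨h1, fun h => h2 (mem_ball_of_adj h h3)⟩, h3⟩
      · exact ⟨h1, h3⟩
      · exact ⟨h1, h3⟩
    · rintro ⟨h1, h3⟩
      by_cases hz : z ∈ ball G u r
      · exact Or.inl (Or.inr ⟨h1, hz, h3⟩)
      · by_cases hz' : z ∈ ball G u (r + 1)
        · exact Or.inr ⟨h1, Finset.mem_sdiff.2 ⟨hz', hz⟩, h3⟩
        · exact Or.inl (Or.inl ⟨(Finset.mem_sdiff.1 h1).1, hz', h3⟩)
  · rw [Finset.disjoint_left]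
    rintro ⟨x, z⟩ h h'
    simp only [Finset.mem_union, mem_outDarts, Finset.mem_filter, Finset.mem_univ, true_and,
      shell, Finset.mem_sdiff] at h h'
    tauto
  · rw [Finset.disjoint_left]
    rintro ⟨x, z⟩ h h'
    simp only [mem_outDarts, Finset.mem_filter, Finset.mem_univ, true_and] at h h'
    exact h.2.1 (ball_subset_succ _ _ _ h'.2.1)

lemma exists_parent (G : SimpleGraph V) (u : V) (r : ℕ) :
    ∃ f : V → V, ∀ x ∈ shell G u r, f x ∈ ball G u r ∧ G.Adj (f x) x := by
  have : ∀ x, ∃ a, x ∈ shell G u r → a ∈ ball G u r ∧ G.Adj a x := by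
    intro x
    by_cases hx : x ∈ shell G u r
    · obtain ⟨a, ha, h⟩ := (mem_shell.1 hx).2
      exact ⟨a, fun _ => ⟨ha, h⟩⟩
    · exact ⟨x, fun h => absurd h hx⟩
  choose f hf using this
  exact ⟨f, hf⟩

lemma card_shell_le (G : SimpleGraph V) (u : V) (r : ℕ) :
    (shell G u r).card ≤ (outDarts G u r).card := by
  obtain ⟨f, hf⟩ := exists_parent G u r
  refine Finset.card_le_card_of_injOn (fun x => (f x, x)) ?_ ?_
  · intro x hx
    exact mem_outDarts.2 ⟨(hf x hx).1, (mem_shell.1 hx).1, (hf x hx).2⟩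
  · intro x _ y _ h
    exact congrArg Prod.snd h

/-- The darts leaving the ball beyond one per shell vertex, and the darts inside the shell, are
redundant. -/
lemma card_excess_le (G : SimpleGraph V) (u : V) (r : ℕ) :
    (outDarts G u r).card + (Finset.univ.filter fun p : V × V =>
        p.1 ∈ shell G u r ∧ p.2 ∈ shell G u r ∧ G.Adj p.1 p.2).card ≤
      (shell G u r).card + (redundantDarts G u (r + 1)).card := by
  obtain ⟨f, hf⟩ := exists_parent G u r
  set H := Finset.univ.filter fun p : V × V =>
        p.1 ∈ shell G u r ∧ p.2 ∈ shell G u r ∧ G.Adj p.1 p.2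
  set I := (shell G u r).image fun x => (f x, x)
  have hI : I.card = (shell G u r).card :=
    Finset.card_image_of_injective _ fun x y h => congrArg Prod.snd h
  -- `I` keeps one parent dart per shell vertex. After deletion of any other counted dart, its shell
  -- ends are still reached through their chosen parents.
  have hsub : (outDarts G u r \ I) ∪ H ⊆ redundantDarts G u (r + 1) := by
    rintro ⟨a, x⟩ hp
    rw [Finset.mem_union] at hp
    rw [mem_redundantDarts]
    rcases hp with hp | hp
    · rw [Finset.mem_sdiff, mem_outDarts] at hp
      obtain ⟨⟨ha, hx, hax⟩, hnI⟩ := hp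
      dsimp only at ha hx hax ⊢
      have hxs : x ∈ shell G u r := mem_shell.2 ⟨hx, a, ha, hax⟩
      have hne : f x ≠ a := by
        rintro rfl
        exact hnI (Finset.mem_image.2 ⟨x, hxs, rfl⟩)
      refine ⟨hax, ball_subset_succ _ _ _ (mem_ball_deleteEdges hx hax ha), ?_⟩
      exact mem_ball_of_adj (mem_ball_deleteEdges hx hax (hf x hxs).1)
        (adj_deleteEdges_of_ne (hf x hxs).2 hne hax.ne')
    · simp only [H, Finset.mem_filter, Finset.mem_univ, true_and] at hp
      obtain ⟨ha, hx, hax⟩ := hp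
      have key : ∀ a x, a ∈ shell G u r → x ∈ shell G u r → G.Adj a x →
          x ∈ ball (G.deleteEdges {s(a, x)}) u (r + 1) := by
        intro a x ha hx hax
        refine mem_ball_of_adj (mem_ball_deleteEdges (mem_shell.1 hx).1 hax (hf x hx).1)
          (adj_deleteEdges_of_ne (hf x hx).2 ?_ hax.ne')
        rintro rfl
        exact (mem_shell.1 ha).1 (hf x hx).1
      refine ⟨hax, ?_, key a x ha hx hax⟩
      have := key x a hx ha hax.symm
      rwa [Sym2.eq_swap] at this
  have hdis : Disjoint (outDarts G u r \ I) H := by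
    rw [Finset.disjoint_left]
    rintro ⟨a, x⟩ h h'
    simp only [H, Finset.mem_filter, Finset.mem_univ, true_and] at h'
    exact (mem_shell.1 h'.1).1 (mem_outDarts.1 (Finset.mem_sdiff.1 h).1).1
  have h1 := Finset.card_le_card hsub
  rw [Finset.card_union_of_disjoint hdis] at h1
  have h2 := Finset.le_card_sdiff I (outDarts G u r)
  omega

lemma card_outDarts_zero {G : SimpleGraph V} {d : ℕ} (hG : IsReg G d) (u : V) :
    (outDarts G u 0).card = d := by
  rw [← hG u]
  symm
  refine Finset.card_bij (fun x _ => (u, x)) ?_ (fun _ _ _ _ h => congrArg Prod.snd h) ?_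
  · intro x hx
    simp only [Finset.mem_filter, Finset.mem_univ, true_and] at hx
    exact mem_outDarts.2 ⟨mem_ball_zero.2 rfl, fun h => hx.ne' (mem_ball_zero.1 h), hx⟩
  · rintro ⟨a, x⟩ h
    obtain ⟨ha, hx, hax⟩ := mem_outDarts.1 h
    obtain rfl := mem_ball_zero.1 ha
    exact ⟨x, by simpa using hax, rfl⟩

lemma card_outDarts_succ_le {G : SimpleGraph V} {q : ℕ} (hG : IsReg G (q + 1)) (u : V) (r : ℕ) :
    (outDarts G u (r + 1)).card ≤ q * (shell G u r).card := by
  have h1 := card_outDarts_succ hG u r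
  have h2 := card_shell_le G u r
  rw [add_mul, one_mul] at h1
  omega

lemma card_outDarts_le {G : SimpleGraph V} {q : ℕ} (hG : IsReg G (q + 1)) (u : V) (r : ℕ) :
    (outDarts G u r).card ≤ (q + 1) * q ^ r := by
  induction r with
  | zero => simp [card_outDarts_zero hG]
  | succ r ih =>
    calc _ ≤ q * (shell G u r).card := card_outDarts_succ_le hG u r
      _ ≤ q * ((q + 1) * q ^ r) := Nat.mul_le_mul_left _ ((card_shell_le G u r).trans ih)
      _ = _ := by ring

/-- The boundary multiplies by q, as in a tree, up to the redundant darts. This is the recursion for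
the deficit. -/
lemma mul_card_outDarts_le {G : SimpleGraph V} {q : ℕ} (hG : IsReg G (q + 1)) (u : V) (r : ℕ) :
    q * (outDarts G u r).card ≤
      (outDarts G u (r + 1)).card + (q + 1) * (redundantDarts G u (r + 1)).card := by
  have h1 := card_outDarts_succ hG u r
  have h2 := card_excess_le G u r
  nlinarith

lemma card_ball_le {G : SimpleGraph V} {q : ℕ} (hq : 2 ≤ q) (hG : IsReg G (q + 1)) (u : V)
    (r : ℕ) : (ball G u r).card ≤ (q + 1) * q ^ r := by
  have key : (ball G u r).card + q ≤ (q + 1) * q ^ r := by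
    induction r with
    | zero => simp [ball, add_comm]
    | succ r ih =>
      have h1 : (ball G u (r + 1)).card ≤ (ball G u r).card + (outDarts G u r).card := by
        have : (ball G u (r + 1)).card = (ball G u r).card + (shell G u r).card := by
          rw [shell, Finset.card_sdiff_of_subset (ball_subset_succ G u r)]
          have := Finset.card_le_card (ball_subset_succ G u r)
          omega
        have := card_shell_le G u r
        omega
      have h2 := card_outDarts_le hG u r
      calc _ ≤ (q + 1) * q ^ r + (q + 1) * q ^ r := by omega
        _ = 2 * ((q + 1) * q ^ r) := by ring
        _ ≤ q * ((q + 1) * q ^ r) := Nat.mul_le_mul_right _ hq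
        _ = _ := by ring
  omega

/-- The number of walks of length `r` from `u` to `x`. -/
noncomputable def walkCount (G : SimpleGraph V) (u : V) (r : ℕ) (x : V) : ℕ :=
  (G.adjMatrix ℕ ^ r) u x

lemma walkCount_zero (G : SimpleGraph V) (u x : V) :
    walkCount G u 0 x = if u = x then 1 else 0 := by
  simp [walkCount, Matrix.one_apply]

lemma walkCount_succ (G : SimpleGraph V) (u x : V) (r : ℕ) :
    walkCount G u (r + 1) x = ∑ a, if G.Adj a x then walkCount G u r a else 0 := by
  simp [walkCount, pow_succ, Matrix.mul_apply, SimpleGraph.adjMatrix_apply]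

lemma mem_ball_of_walkCount {G : SimpleGraph V} {u x : V} {r : ℕ} (h : walkCount G u r x ≠ 0) :
    x ∈ ball G u r := by
  induction r generalizing x with
  | zero =>
    rw [walkCount_zero] at h
    rw [mem_ball_zero]
    by_contra h'
    exact h (if_neg fun e => h' e.symm)
  | succ r ih =>
    rw [walkCount_succ] at h
    obtain ⟨a, -, ha⟩ := Finset.exists_ne_zero_of_sum_ne_zero h
    have hax : G.Adj a x := by
      by_contra h'
      exact ha (if_neg h')
    rw [if_pos hax] at ha
    exact mem_ball_of_adj (ih ha) hax

lemma walkCount_pos_of_shell {G : SimpleGraph V} {u x : V} {r : ℕ} (h : x ∈ ball G u r)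
    (h' : ∀ s < r, x ∉ ball G u s) : 0 < walkCount G u r x := by
  induction r generalizing x with
  | zero =>
    rw [mem_ball_zero] at h
    simp [walkCount_zero, h]
  | succ r ih =>
    rcases mem_ball_succ.1 h with h | ⟨a, ha, hax⟩
    · exact absurd h (h' r (by omega))
    · rw [walkCount_succ]
      refine Finset.sum_pos' (fun _ _ => Nat.zero_le _) ⟨a, Finset.mem_univ _, ?_⟩
      rw [if_pos hax]
      refine ih ha fun s hs hs' => h' (s + 1) (by omega) (mem_ball_of_adj hs' hax)

lemma walkCount_pos_of_outDarts {G : SimpleGraph V} {u : V} {r : ℕ} {p : V × V}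
    (h : p ∈ outDarts G u r) : 0 < walkCount G u r p.1 := by
  obtain ⟨h1, h2, h3⟩ := mem_outDarts.1 h
  exact walkCount_pos_of_shell h1 fun s hs => not_mem_ball_of_adj h2 h3 hs

/-- The last step of a walk of length r + 1 that ends at distance r + 1 is a dart leaving the ball
of radius r. -/
lemma sum_walkCount_shell (G : SimpleGraph V) (u : V) (r : ℕ) :
    ∑ x ∈ shell G u r, walkCount G u (r + 1) x = ∑ p ∈ outDarts G u r, walkCount G u r p.1 := by
  have h1 : ∀ x ∈ shell G u r, walkCount G u (r + 1) x =
      ∑ a, if (a, x) ∈ outDarts G u r then walkCount G u r a else 0 := by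
    intro x hx
    rw [walkCount_succ]
    refine Finset.sum_congr rfl fun a _ => ?_
    by_cases hax : G.Adj a x
    · by_cases ha : a ∈ ball G u r
      · rw [if_pos hax, if_pos (mem_outDarts.2 ⟨ha, (mem_shell.1 hx).1, hax⟩)]
      · have : walkCount G u r a = 0 := by
          by_contra h
          exact ha (mem_ball_of_walkCount h)
        simp [this]
    · rw [if_neg hax, if_neg fun h => hax (mem_outDarts.1 h).2.2]
  rw [Finset.sum_congr rfl h1, Finset.sum_comm]
  have h2 : ∀ a : V, (∑ x ∈ shell G u r, if (a, x) ∈ outDarts G u r then walkCount G u r a else 0)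
      = ∑ x, if (a, x) ∈ outDarts G u r then walkCount G u r a else 0 := by
    intro a
    refine Finset.sum_subset (Finset.subset_univ _) fun x _ hx => if_neg fun h => hx ?_
    obtain ⟨h1, h2, h3⟩ := mem_outDarts.1 h
    exact mem_shell.2 ⟨h2, a, h1, h3⟩
  rw [Finset.sum_congr rfl fun a _ => h2 a, ← Fintype.sum_prod_type', ← Finset.sum_filter]
  congr 1
  ext p
  simp

/-- The sum counts walks that move away from u at every step: q + 1 choices at first, then at most
q, since a neighbour one step nearer to u is excluded. -/
lemma sum_walkCount_outDarts_le {G : SimpleGraph V} {q : ℕ} (hG : IsReg G (q + 1)) (u : V)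
    (r : ℕ) : ∑ p ∈ outDarts G u r, walkCount G u r p.1 ≤ (q + 1) * q ^ r := by
  induction r with
  | zero =>
    rw [Finset.sum_congr rfl (g := fun _ => 1)]
    · simp [card_outDarts_zero hG]
    · intro p hp
      simp [walkCount_zero, mem_ball_zero.1 (mem_outDarts.1 hp).1]
  | succ r ih =>
    have h1 : ∑ p ∈ outDarts G u (r + 1), walkCount G u (r + 1) p.1 =
        ∑ x ∈ shell G u r, ∑ p ∈ (outDarts G u (r + 1)).filter (fun p => p.1 = x),
          walkCount G u (r + 1) x := by
      rw [← Finset.sum_fiberwise_of_maps_to (s := outDarts G u (r + 1)) (t := shell G u r)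
        (g := Prod.fst)]
      · refine Finset.sum_congr rfl fun x _ => Finset.sum_congr rfl fun p hp => ?_
        rw [(Finset.mem_filter.1 hp).2]
      · intro p hp
        obtain ⟨h1, h2, h3⟩ := mem_outDarts.1 hp
        exact Finset.mem_sdiff.2 ⟨h1, not_mem_ball_of_adj h2 h3 (Nat.lt_succ_self r)⟩
    have h2 : ∀ x ∈ shell G u r,
        ((outDarts G u (r + 1)).filter (fun p => p.1 = x)).card ≤ q := by
      intro x hx
      obtain ⟨a, ha, hax⟩ := (mem_shell.1 hx).2
      have hc : ((outDarts G u (r + 1)).filter (fun p => p.1 = x)).card ≤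
          ((Finset.univ.filter fun w => G.Adj x w).erase a).card := by
        refine Finset.card_le_card_of_injOn Prod.snd ?_ ?_
        · rintro ⟨y, z⟩ hp
          obtain ⟨hp', rfl⟩ := Finset.mem_filter.1 hp
          obtain ⟨h1, h2, h3⟩ := mem_outDarts.1 hp'
          simp only [Finset.coe_erase, Set.mem_sdiff, Finset.mem_coe, Finset.mem_filter,
            Finset.mem_univ, true_and, Set.mem_singleton_iff]
          refine ⟨h3, ?_⟩
          rintro rfl
          exact h2 (ball_subset_succ _ _ _ ha)
        · rintro ⟨y, z⟩ hp ⟨y', z'⟩ hp' h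
          have e1 := (Finset.mem_filter.1 hp).2
          have e2 := (Finset.mem_filter.1 hp').2
          simp only at e1 e2 h
          rw [e1, e2, h]
      rw [Finset.card_erase_of_mem (by simpa using hax.symm), hG x] at hc
      simpa using hc
    rw [h1]
    calc _ ≤ ∑ x ∈ shell G u r, q * walkCount G u (r + 1) x := by
          refine Finset.sum_le_sum fun x hx => ?_
          rw [Finset.sum_const, smul_eq_mul]
          exact Nat.mul_le_mul_right _ (h2 x hx)
      _ = q * ∑ p ∈ outDarts G u r, walkCount G u r p.1 := by
          rw [← Finset.mul_sum, sum_walkCount_shell]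
      _ ≤ q * ((q + 1) * q ^ r) := Nat.mul_le_mul_left _ ih
      _ = _ := by ring

/-- Few darts leave the ball from vertices reached by several walks. -/
lemma card_multi_add_card_outDarts_le {G : SimpleGraph V} {q : ℕ} (hG : IsReg G (q + 1)) (u : V)
    (r : ℕ) : ((outDarts G u r).filter fun p => walkCount G u r p.1 ≠ 1).card +
      (outDarts G u r).card ≤ (q + 1) * q ^ r := by
  -- Every boundary dart starts at a vertex with walk count at least 1, and a multiply reached one
  -- has count at least 2, which pays for its second appearance on the left.
  refine le_trans ?_ (sum_walkCount_outDarts_le hG u r)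
  rw [Finset.card_filter, Finset.card_eq_sum_ones, ← Finset.sum_add_distrib]
  refine Finset.sum_le_sum fun p hp => ?_
  have := walkCount_pos_of_outDarts hp
  split_ifs <;> omega

end
end RandomRegular

/-! ### Switchings, and the scarcity of redundant darts -/

namespace RandomRegular
section
open Classical

variable {V : Type*} [Fintype V]

/-- Toggle the edges of the four-cycle `a b y x`. -/
def switch (G : SimpleGraph V) (a b x y : V) : SimpleGraph V where
  Adj p r := p ≠ r ∧ (G.Adj p r ↔ ¬
    (s(p, r) = s(a, b) ∨ s(p, r) = s(x, y) ∨ s(p, r) = s(a, x) ∨ s(p, r) = s(b, y)))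
  symm := ⟨fun p r h => by
    rw [Sym2.eq_swap, G.adj_comm]
    exact ⟨h.1.symm, h.2⟩⟩
  loopless := ⟨fun _ h => h.1 rfl⟩

lemma switch_adj {G : SimpleGraph V} {a b x y p r : V} : (switch G a b x y).Adj p r ↔
    p ≠ r ∧ (G.Adj p r ↔ ¬
    (s(p, r) = s(a, b) ∨ s(p, r) = s(x, y) ∨ s(p, r) = s(a, x) ∨ s(p, r) = s(b, y))) := Iff.rfl

/-- Toggling is an involution with no hypothesis on the four vertices, so injectivity and inverse
laws for switchings come for free. -/
lemma switch_switch (G : SimpleGraph V) (a b x y : V) :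
    switch (switch G a b x y) a b x y = G := by
  ext p r
  simp only [switch_adj]
  have := fun h : G.Adj p r => h.ne
  tauto

lemma switch_comm (G : SimpleGraph V) (a b x y : V) : switch G a b x y = switch G a x b y := by
  ext p r
  simp only [switch_adj]
  tauto

lemma switch_flip (G : SimpleGraph V) (a b x y : V) : switch G a b x y = switch G b a y x := by
  ext p r
  simp only [switch_adj, Sym2.eq_swap (a := b) (b := a), Sym2.eq_swap (a := y) (b := x)]
  tauto

lemma switch_swap (G : SimpleGraph V) (a b x y : V) : switch G a b x y = switch G x y a b := by
  ext p r
  simp only [switch_adj, Sym2.eq_swap (a := x) (b := a), Sym2.eq_swap (a := y) (b := b)]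
  tauto

/-- The edges `ab`, `xy` can be replaced by `ax`, `by`. -/
structure Switchable (G : SimpleGraph V) (a b x y : V) : Prop where
  ab : G.Adj a b
  xy : G.Adj x y
  nax : ¬ G.Adj a x
  nby : ¬ G.Adj b y
  ax : a ≠ x
  ne_by : b ≠ y

namespace Switchable

variable {G : SimpleGraph V} {a b x y : V}

lemma ay (h : Switchable G a b x y) : a ≠ y := by
  rintro rfl
  exact h.nby h.ab.symm

lemma bx (h : Switchable G a b x y) : b ≠ x := by
  rintro rfl
  exact h.nax h.ab

lemma flip (h : Switchable G a b x y) : Switchable G b a y x :=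
  ⟨h.ab.symm, h.xy.symm, h.nby, h.nax, h.ne_by, h.ax⟩

lemma swap (h : Switchable G a b x y) : Switchable G x y a b :=
  ⟨h.xy, h.ab, fun h' => h.nax h'.symm, fun h' => h.nby h'.symm, h.ax.symm, h.ne_by.symm⟩

lemma adj_iff (h : Switchable G a b x y) {p r : V} : (switch G a b x y).Adj p r ↔
    (G.Adj p r ∧ s(p, r) ≠ s(a, b) ∧ s(p, r) ≠ s(x, y)) ∨ s(p, r) = s(a, x) ∨
      s(p, r) = s(b, y) := by
  have h1 : s(p, r) = s(a, b) → G.Adj p r := fun e => by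
    rw [← SimpleGraph.mem_edgeSet, e, SimpleGraph.mem_edgeSet]; exact h.ab
  have h2 : s(p, r) = s(x, y) → G.Adj p r := fun e => by
    rw [← SimpleGraph.mem_edgeSet, e, SimpleGraph.mem_edgeSet]; exact h.xy
  have h3 : s(p, r) = s(a, x) → ¬ G.Adj p r := fun e => by
    rw [← SimpleGraph.mem_edgeSet, e, SimpleGraph.mem_edgeSet]; exact h.nax
  have h4 : s(p, r) = s(b, y) → ¬ G.Adj p r := fun e => by
    rw [← SimpleGraph.mem_edgeSet, e, SimpleGraph.mem_edgeSet]; exact h.nby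
  have h5 : s(p, r) = s(a, x) → p ≠ r := by
    rintro e rfl
    rw [eq_comm, Sym2.eq_iff] at e
    rcases e with ⟨e, e'⟩ | ⟨e, e'⟩ <;> exact h.ax (e.trans e'.symm)
  have h6 : s(p, r) = s(b, y) → p ≠ r := by
    rintro e rfl
    rw [eq_comm, Sym2.eq_iff] at e
    rcases e with ⟨e, e'⟩ | ⟨e, e'⟩ <;> exact h.ne_by (e.trans e'.symm)
  have h7 : G.Adj p r → p ≠ r := fun e => e.ne
  rw [switch_adj]
  clear h
  grind

/-- The same four-cycle undoes the switching, with b and x exchanging roles. -/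
lemma symm (h : Switchable G a b x y) : Switchable (switch G a b x y) a x b y := by
  have h0 := h.ab.ne
  have h1 := h.xy.ne
  have h2 := h.ax
  have h3 := h.ne_by
  have h4 := h.ay
  have h5 := h.bx
  refine ⟨?_, ?_, ?_, ?_, h0, h1⟩ <;> rw [h.adj_iff]
  · exact Or.inr (Or.inl rfl)
  · exact Or.inr (Or.inr rfl)
  · simp [h0, h2, h3, h4, h5, h0.symm]
  · simp [h1, h1.symm, h4.symm, h5.symm]

lemma card_nbrs_left (h : Switchable G a b x y) :
    (Finset.univ.filter fun w => (switch G a b x y).Adj a w).card =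
      (Finset.univ.filter fun w => G.Adj a w).card := by
  have e : (Finset.univ.filter fun w => (switch G a b x y).Adj a w) =
      insert x ((Finset.univ.filter fun w => G.Adj a w).erase b) := by
    ext w
    simp only [Finset.mem_filter, Finset.mem_univ, true_and, h.adj_iff, Finset.mem_insert,
      Finset.mem_erase, Sym2.eq_iff, ne_eq]
    have h0 := h.ab.ne
    have h2 := h.ax
    have h4 := h.ay
    tauto
  have h1 : b ∈ Finset.univ.filter fun w => G.Adj a w := by simpa using h.ab
  rw [e, Finset.card_insert_of_notMem (by simp [h.nax]), Finset.card_erase_of_mem h1]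
  have := Finset.card_pos.2 ⟨b, h1⟩
  omega

/-- Each of the four vertices loses one neighbour and gains one; the symmetries `flip` and `swap`
reduce all four to the vertex a. -/
lemma isReg (h : Switchable G a b x y) {d : ℕ} (hG : IsReg G d) :
    IsReg (switch G a b x y) d := by
  intro w
  by_cases ha : w = a
  · subst ha
    rw [h.card_nbrs_left, hG]
  by_cases hb : w = b
  · subst hb
    rw [switch_flip, h.flip.card_nbrs_left, hG]
  by_cases hx : w = x
  · subst hx
    rw [switch_swap, h.swap.card_nbrs_left, hG]
  by_cases hy : w = y
  · subst hy
    rw [switch_swap, switch_flip, h.swap.flip.card_nbrs_left, hG]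
  rw [← hG w]
  congr 1
  ext r
  simp only [Finset.mem_filter, Finset.mem_univ, true_and, h.adj_iff, Sym2.eq_iff, ne_eq]
  tauto

end Switchable

lemma switch_adj_of_ne {G : SimpleGraph V} {a b x y p r : V} (ha : p ≠ a) (hb : p ≠ b)
    (hx : p ≠ x) (hy : p ≠ y) : G.Adj p r ↔ (switch G a b x y).Adj p r := by
  rw [switch_adj]
  simp only [Sym2.eq_iff]
  have := fun h : G.Adj p r => h.ne
  tauto

lemma ball_switch {G : SimpleGraph V} {u a b x y : V} {i : ℕ}
    (ha : ∀ s < i, a ∉ ball G u s) (hb : ∀ s < i, b ∉ ball G u s)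
    (hx : ∀ s < i, x ∉ ball G u s) (hy : ∀ s < i, y ∉ ball G u s) {r : ℕ} (hr : r ≤ i) :
    ball (switch G a b x y) u r = ball G u r := by
  refine ball_congr (i := i) (fun s hs w hw z => switch_adj_of_ne ?_ ?_ ?_ ?_) hr <;> rintro rfl
  exacts [ha s hs hw, hb s hs hw, hx s hs hw, hy s hs hw]

lemma card_filter_mem_prod {α β : Type*} [Fintype α] [Fintype β] (S : Finset α)
    (P : α → β → Prop) [DecidablePred fun p : α × β => p.1 ∈ S ∧ P p.1 p.2]
    [∀ a, DecidablePred (P a)] :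
    (Finset.univ.filter fun p : α × β => p.1 ∈ S ∧ P p.1 p.2).card =
      ∑ a ∈ S, (Finset.univ.filter (P a)).card := by
  rw [Finset.card_filter, Fintype.sum_prod_type, ← Finset.sum_subset (Finset.subset_univ S)]
  · exact Finset.sum_congr rfl fun a ha => by rw [Finset.card_filter]; simp [ha]
  · intro a _ ha
    simp [ha]

lemma card_darts_right {G : SimpleGraph V} {d : ℕ} (hG : IsReg G d) (S : Finset V) :
    (Finset.univ.filter fun p : V × V => p.2 ∈ S ∧ G.Adj p.1 p.2).card = d * S.card := by
  rw [← card_shell_darts hG]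
  refine Finset.card_bij (fun p _ => p.swap) ?_ (fun _ _ _ _ h => Prod.swap_injective h) ?_
  · rintro ⟨a, b⟩ h
    simpa [G.adj_comm] using h
  · rintro ⟨a, b⟩ h
    exact ⟨(b, a), by simpa [G.adj_comm] using h, rfl⟩

/-- Most darts avoid a small vertex set and the neighbourhoods of two given vertices. -/
lemma card_avoiding_darts {G : SimpleGraph V} {d : ℕ} (hG : IsReg G d) (K : Finset V) (a b : V) :
    d * Fintype.card V ≤ (Finset.univ.filter fun p : V × V => G.Adj p.1 p.2 ∧ p.1 ∉ K ∧ p.2 ∉ K ∧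
      ¬ G.Adj a p.1 ∧ ¬ G.Adj b p.2).card + (2 * d * K.card + 2 * d ^ 2) := by
  set N := fun v => Finset.univ.filter fun w => G.Adj v w
  have h := card_shell_darts hG Finset.univ
  rw [Finset.card_univ] at h
  rw [← h]
  have hsub : (Finset.univ.filter fun p : V × V => p.1 ∈ Finset.univ ∧ G.Adj p.1 p.2) ⊆
      ((((Finset.univ.filter fun p : V × V => G.Adj p.1 p.2 ∧ p.1 ∉ K ∧ p.2 ∉ K ∧
      ¬ G.Adj a p.1 ∧ ¬ G.Adj b p.2) ∪
      (Finset.univ.filter fun p : V × V => p.1 ∈ K ∧ G.Adj p.1 p.2)) ∪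
      (Finset.univ.filter fun p : V × V => p.2 ∈ K ∧ G.Adj p.1 p.2)) ∪
      (Finset.univ.filter fun p : V × V => p.1 ∈ N a ∧ G.Adj p.1 p.2)) ∪
      (Finset.univ.filter fun p : V × V => p.2 ∈ N b ∧ G.Adj p.1 p.2) := by
    intro p
    simp only [N, Finset.mem_union, Finset.mem_filter, Finset.mem_univ, true_and]
    tauto
  have h1 := Finset.card_le_card hsub
  have e1 := card_shell_darts hG K
  have e2 := card_darts_right hG K
  have e3 := card_shell_darts hG (N a)
  have e4 := card_darts_right hG (N b)
  have e5 : (N a).card = d := hG a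
  have e6 : (N b).card = d := hG b
  have b1 := Finset.card_union_le ((((Finset.univ.filter fun p : V × V => G.Adj p.1 p.2 ∧
      p.1 ∉ K ∧ p.2 ∉ K ∧ ¬ G.Adj a p.1 ∧ ¬ G.Adj b p.2) ∪
      (Finset.univ.filter fun p : V × V => p.1 ∈ K ∧ G.Adj p.1 p.2)) ∪
      (Finset.univ.filter fun p : V × V => p.2 ∈ K ∧ G.Adj p.1 p.2)) ∪
      (Finset.univ.filter fun p : V × V => p.1 ∈ N a ∧ G.Adj p.1 p.2))
      (Finset.univ.filter fun p : V × V => p.2 ∈ N b ∧ G.Adj p.1 p.2)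
  have b2 := Finset.card_union_le (((Finset.univ.filter fun p : V × V => G.Adj p.1 p.2 ∧
      p.1 ∉ K ∧ p.2 ∉ K ∧ ¬ G.Adj a p.1 ∧ ¬ G.Adj b p.2) ∪
      (Finset.univ.filter fun p : V × V => p.1 ∈ K ∧ G.Adj p.1 p.2)) ∪
      (Finset.univ.filter fun p : V × V => p.2 ∈ K ∧ G.Adj p.1 p.2))
      (Finset.univ.filter fun p : V × V => p.1 ∈ N a ∧ G.Adj p.1 p.2)
  have b3 := Finset.card_union_le ((Finset.univ.filter fun p : V × V => G.Adj p.1 p.2 ∧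
      p.1 ∉ K ∧ p.2 ∉ K ∧ ¬ G.Adj a p.1 ∧ ¬ G.Adj b p.2) ∪
      (Finset.univ.filter fun p : V × V => p.1 ∈ K ∧ G.Adj p.1 p.2))
      (Finset.univ.filter fun p : V × V => p.2 ∈ K ∧ G.Adj p.1 p.2)
  have b4 := Finset.card_union_le (Finset.univ.filter fun p : V × V => G.Adj p.1 p.2 ∧
      p.1 ∉ K ∧ p.2 ∉ K ∧ ¬ G.Adj a p.1 ∧ ¬ G.Adj b p.2)
      (Finset.univ.filter fun p : V × V => p.1 ∈ K ∧ G.Adj p.1 p.2)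
  rw [e5] at e3
  rw [e6] at e4
  rw [sq, mul_assoc 2]
  omega

/-- The set of all `d`-regular graphs on `V`. -/
noncomputable def regGraphs (V : Type*) [Fintype V] (d : ℕ) : Finset (SimpleGraph V) :=
  Finset.univ.filter fun G => IsReg G d

lemma mem_regGraphs {G : SimpleGraph V} {d : ℕ} : G ∈ regGraphs V d ↔ IsReg G d := by
  simp [regGraphs]

/-- Switching bound for the number of redundant darts. -/
lemma sum_redundantDarts_mul_le {q : ℕ} (hq : 2 ≤ q) (u : V) (t : ℕ) :
    (∑ G ∈ regGraphs V (q + 1), (redundantDarts G u t).card) * ((q + 1) * Fintype.card V) ≤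
      (regGraphs V (q + 1)).card * ((q + 1) * ((q + 1) * q ^ t)) ^ 2 +
      (∑ G ∈ regGraphs V (q + 1), (redundantDarts G u t).card) *
        (2 * (q + 1) * ((q + 1) * q ^ t) + 2 * (q + 1) ^ 2) := by
  set S : Finset (SimpleGraph V × (V × V) × (V × V)) := Finset.univ.filter fun p =>
    p.1 ∈ regGraphs V (q + 1) ∧ p.2.1 ∈ redundantDarts p.1 u t ∧ (p.1.Adj p.2.2.1 p.2.2.2 ∧
      p.2.2.1 ∉ ball p.1 u t ∧ p.2.2.2 ∉ ball p.1 u t ∧ ¬ p.1.Adj p.2.1.1 p.2.2.1 ∧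
      ¬ p.1.Adj p.2.1.2 p.2.2.2) with hS
  set R : Finset (SimpleGraph V × (V × V) × (V × V)) := Finset.univ.filter fun p =>
    p.1 ∈ regGraphs V (q + 1) ∧ (p.2.1.1 ∈ ball p.1 u t ∧ p.1.Adj p.2.1.1 p.2.1.2) ∧
      (p.2.2.1 ∈ ball p.1 u t ∧ p.1.Adj p.2.2.1 p.2.2.2) with hR
  -- Switching a redundant dart ab with an edge xy outside the ball gives two darts ax, by that
  -- start in the ball. There are about (q + 1)n choices of xy but only boundedly many pairs of
  -- darts in terms of the ball size, hence the bound.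
  have hSR : S.card ≤ R.card := by
    refine Finset.card_le_card_of_injOn (fun p => (switch p.1 p.2.1.1 p.2.1.2 p.2.2.1 p.2.2.2,
      (p.2.1.1, p.2.2.1), (p.2.1.2, p.2.2.2))) ?_ ?_
    · rintro ⟨G, ⟨a, b⟩, ⟨x, y⟩⟩ h
      simp only [hS, Finset.coe_filter, Finset.mem_univ, true_and, Set.mem_ofPred_eq,
        mem_redundantDarts, mem_regGraphs] at h
      obtain ⟨hG, ⟨hab, ha, hb⟩, hxy, hx, hy, hax, hby⟩ := h
      have hle := SimpleGraph.deleteEdges_le (G := G) {s(a, b)}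
      have ha' := ball_mono_graph hle u t ha
      have hb' := ball_mono_graph hle u t hb
      have hsw : Switchable G a b x y := ⟨hab, hxy, hax, hby,
        fun e => hx (e ▸ ha'), fun e => hy (e ▸ hb')⟩
      -- Redundancy enters here: a and b are in the ball without the edge ab, and the removal of xy
      -- is harmless because x and y lie outside.
      have hsub : ball (G.deleteEdges {s(a, b)}) u t ⊆ ball (switch G a b x y) u t := by
        refine ball_subset_of_adj fun r hr w hw z hz hwz => ?_
        rw [SimpleGraph.deleteEdges_adj, Set.mem_singleton_iff] at hwz
        refine hsw.adj_iff.2 (Or.inl ⟨hwz.1, hwz.2, fun e => ?_⟩)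
        have hw' := ball_mono G u hr.le (ball_mono_graph hle u r hw)
        rw [Sym2.eq_iff] at e
        rcases e with ⟨rfl, rfl⟩ | ⟨rfl, rfl⟩
        exacts [hx hw', hy hw']
      simp only [hR, Finset.coe_filter, Finset.mem_univ, true_and, Set.mem_ofPred_eq,
        mem_regGraphs]
      exact ⟨hsw.isReg hG, ⟨hsub ha, hsw.symm.ab⟩, hsub hb, hsw.symm.xy⟩
    · rintro ⟨G, ⟨a, b⟩, ⟨x, y⟩⟩ _ ⟨G', ⟨a', b'⟩, ⟨x', y'⟩⟩ _ h
      simp only [Prod.mk.injEq] at h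
      obtain ⟨h, ⟨rfl, rfl⟩, rfl, rfl⟩ := h
      have := congrArg (fun H => switch H a b x y) h
      simp only [switch_switch] at this
      rw [this]
  have hRc : R.card ≤ (regGraphs V (q + 1)).card * ((q + 1) * ((q + 1) * q ^ t)) ^ 2 := by
    rw [hR, card_filter_mem_prod (regGraphs V (q + 1)) (fun (G : SimpleGraph V) (p : (V × V) × (V × V)) => (p.1.1 ∈ ball G u t ∧
      G.Adj p.1.1 p.1.2) ∧ (p.2.1 ∈ ball G u t ∧ G.Adj p.2.1 p.2.2))]
    rw [← smul_eq_mul (a := (regGraphs V (q + 1)).card)]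
    refine Finset.sum_le_card_nsmul _ _ _ fun G hG => ?_
    have hG := mem_regGraphs.1 hG
    rw [← Finset.univ_product_univ, Finset.filter_product (p := fun p : V × V => p.1 ∈ ball G u t ∧ G.Adj p.1 p.2) (q := fun p : V × V => p.1 ∈ ball G u t ∧ G.Adj p.1 p.2), Finset.card_product,
      card_shell_darts hG, ← sq]
    exact Nat.pow_le_pow_left (Nat.mul_le_mul_left _ (card_ball_le hq hG u t)) 2
  have hSc : (∑ G ∈ regGraphs V (q + 1), (redundantDarts G u t).card) *
      ((q + 1) * Fintype.card V) ≤ S.card +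
      (∑ G ∈ regGraphs V (q + 1), (redundantDarts G u t).card) *
        (2 * (q + 1) * ((q + 1) * q ^ t) + 2 * (q + 1) ^ 2) := by
    rw [hS, card_filter_mem_prod (regGraphs V (q + 1)) (fun (G : SimpleGraph V) (p : (V × V) × (V × V)) => p.1 ∈ redundantDarts G u t ∧
      (G.Adj p.2.1 p.2.2 ∧ p.2.1 ∉ ball G u t ∧ p.2.2 ∉ ball G u t ∧ ¬ G.Adj p.1.1 p.2.1 ∧
      ¬ G.Adj p.1.2 p.2.2)), Finset.sum_mul, Finset.sum_mul, ← Finset.sum_add_distrib]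
    refine Finset.sum_le_sum fun G hG => ?_
    have hG := mem_regGraphs.1 hG
    rw [card_filter_mem_prod (redundantDarts G u t) (fun (e p : V × V) =>
      (G.Adj p.1 p.2 ∧ p.1 ∉ ball G u t ∧ p.2 ∉ ball G u t ∧ ¬ G.Adj e.1 p.1 ∧
      ¬ G.Adj e.2 p.2)), Finset.card_eq_sum_ones, Finset.sum_mul, Finset.sum_mul,
      ← Finset.sum_add_distrib]
    refine Finset.sum_le_sum fun e _ => ?_
    rw [one_mul, one_mul]
    refine (card_avoiding_darts hG (ball G u t) e.1 e.2).trans ?_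
    gcongr
    exact card_ball_le hq hG u t
  omega

end
end RandomRegular

/-! ### Switching the edges that join two disjoint balls -/

namespace RandomRegular
section
open Classical

variable {V : Type*} [Fintype V]

/-- The darts from the ball of radius `i` around `u` to the ball of radius `j` around `v`. -/
noncomputable def midDarts (G : SimpleGraph V) (u v : V) (i j : ℕ) : Finset (V × V) :=
  Finset.univ.filter fun p => p.1 ∈ ball G u i ∧ p.2 ∈ ball G v j ∧ G.Adj p.1 p.2

lemma mem_midDarts {G : SimpleGraph V} {u v : V} {i j : ℕ} {p : V × V} :
    p ∈ midDarts G u v i j ↔ p.1 ∈ ball G u i ∧ p.2 ∈ ball G v j ∧ G.Adj p.1 p.2 := by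
  simp [midDarts]

/-- The regular graphs in which the two balls are disjoint and joined by exactly `l` edges. -/
noncomputable def midGraphs (d : ℕ) (u v : V) (i j l : ℕ) : Finset (SimpleGraph V) :=
  (regGraphs V d).filter fun G => Disjoint (ball G u i) (ball G v j) ∧
    (midDarts G u v i j).card = l

lemma mem_midGraphs {d : ℕ} {G : SimpleGraph V} {u v : V} {i j l : ℕ} :
    G ∈ midGraphs d u v i j l ↔ IsReg G d ∧ Disjoint (ball G u i) (ball G v j) ∧
      (midDarts G u v i j).card = l := by
  rw [midGraphs, Finset.mem_filter, mem_regGraphs]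

/-- Pairs of darts `ab`, `xy` to be switched so as to remove the edge `ab` between the balls. -/
noncomputable def cutPairs (G : SimpleGraph V) (u v : V) (i j : ℕ) :
    Finset ((V × V) × (V × V)) :=
  Finset.univ.filter fun p => p.1 ∈ midDarts G u v i j ∧ (G.Adj p.2.1 p.2.2 ∧
    p.2.1 ∉ ball G u i ∪ ball G v j ∧ p.2.2 ∉ ball G u i ∪ ball G v j ∧
    ¬ G.Adj p.1.1 p.2.1 ∧ ¬ G.Adj p.1.2 p.2.2)

/-- Pairs of darts `ax`, `by` to be switched so as to create an edge `ab` between the balls. -/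
noncomputable def linkPairs (G : SimpleGraph V) (u v : V) (i j : ℕ) :
    Finset ((V × V) × (V × V)) :=
  (outDarts G u i ×ˢ outDarts G v j).filter fun p => p.1.2 ∉ ball G v j ∧ p.2.2 ∉ ball G u i ∧
    ¬ G.Adj p.1.1 p.2.1 ∧ ¬ G.Adj p.1.2 p.2.2 ∧ p.1.2 ≠ p.2.2

/-- The vertices a and b lie on the last spheres and x, y outside both balls, so no explored edge
changes. Of the four toggled pairs only ab has an end in each ball. -/
lemma balls_switch {G : SimpleGraph V} {u v a b x y : V} {i j : ℕ}
    (hd : Disjoint (ball G u i) (ball G v j)) (ha : a ∈ ball G u i) (hb : b ∈ ball G v j)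
    (ha' : ∀ s < i, a ∉ ball G u s) (hb' : ∀ s < j, b ∉ ball G v s)
    (hx : x ∉ ball G u i ∪ ball G v j) (hy : y ∉ ball G u i ∪ ball G v j) :
    ball (switch G a b x y) u i = ball G u i ∧ ball (switch G a b x y) v j = ball G v j ∧
    ∀ p : V × V, p ∈ midDarts (switch G a b x y) u v i j ↔
      (p ∈ midDarts G u v i j ↔ ¬ p = (a, b)) := by
  rw [Finset.notMem_union] at hx hy
  have hau : a ∉ ball G v j := Finset.disjoint_left.1 hd ha
  have hbu : b ∉ ball G u i := Finset.disjoint_right.1 hd hb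
  have e1 : ball (switch G a b x y) u i = ball G u i :=
    ball_switch ha' (fun s hs h => hbu (ball_mono G u hs.le h))
      (fun s hs h => hx.1 (ball_mono G u hs.le h)) (fun s hs h => hy.1 (ball_mono G u hs.le h)) le_rfl
  have e2 : ball (switch G a b x y) v j = ball G v j :=
    ball_switch (fun s hs h => hau (ball_mono G v hs.le h)) hb'
      (fun s hs h => hx.2 (ball_mono G v hs.le h)) (fun s hs h => hy.2 (ball_mono G v hs.le h)) le_rfl
  refine ⟨e1, e2, ?_⟩
  rintro ⟨p, r⟩
  rw [mem_midDarts, mem_midDarts, e1, e2]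
  simp only [Prod.mk.injEq]
  by_cases hp : p ∈ ball G u i
  · by_cases hr : r ∈ ball G v j
    · have n1 : p ≠ r := fun h => Finset.disjoint_left.1 hd hp (h ▸ hr)
      have n2 : p ≠ b := fun h => hbu (h ▸ hp)
      have n3 : p ≠ x := fun h => hx.1 (h ▸ hp)
      have n4 : p ≠ y := fun h => hy.1 (h ▸ hp)
      have n5 : r ≠ x := fun h => hx.2 (h ▸ hr)
      have n6 : r ≠ y := fun h => hy.2 (h ▸ hr)
      simp only [hp, hr, true_and, switch_adj, Sym2.eq_iff, n1, n2, n3, n4, n5, n6, false_and,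
        and_false, or_false, ne_eq, not_false_eq_true]
    · have : ¬ (p = a ∧ r = b) := fun h => hr (h.2 ▸ hb)
      simp [hr, this]
  · have : ¬ (p = a ∧ r = b) := fun h => hp (h.1 ▸ ha)
    simp [hp, this]

/-- Switching is a bijection between cut pairs and link pairs. -/
lemma sum_card_cutPairs (d : ℕ) (u v : V) (i j l : ℕ) :
    ∑ G ∈ midGraphs d u v i j (l + 1), (cutPairs G u v i j).card =
      ∑ G ∈ midGraphs d u v i j l, (linkPairs G u v i j).card := by
  rw [← Finset.card_sigma, ← Finset.card_sigma]
  refine Finset.card_nbij'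
    (fun p => ⟨switch p.1 p.2.1.1 p.2.1.2 p.2.2.1 p.2.2.2,
      ((p.2.1.1, p.2.2.1), (p.2.1.2, p.2.2.2))⟩)
    (fun p => ⟨switch p.1 p.2.1.1 p.2.1.2 p.2.2.1 p.2.2.2,
      ((p.2.1.1, p.2.2.1), (p.2.1.2, p.2.2.2))⟩) ?_ ?_ ?_ ?_
  · rintro ⟨G, ⟨a, b⟩, ⟨x, y⟩⟩ h
    simp only [Finset.coe_sigma, Set.mem_sigma_iff, Finset.mem_coe, mem_midGraphs, cutPairs,
      Finset.mem_filter, Finset.mem_univ, true_and, mem_midDarts] at h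
    obtain ⟨⟨hG, hd, hc⟩, ⟨ha, hb, hab⟩, hxy, hx, hy, hax, hby⟩ := h
    have hau : a ∉ ball G v j := Finset.disjoint_left.1 hd ha
    have hbu : b ∉ ball G u i := Finset.disjoint_right.1 hd hb
    have hx' := Finset.notMem_union.1 hx
    have hy' := Finset.notMem_union.1 hy
    have hsw : Switchable G a b x y := ⟨hab, hxy, hax, hby, fun e => hx'.1 (e ▸ ha),
      fun e => hy'.2 (e ▸ hb)⟩
    -- Disjointness forces a and b to lie at distances exactly i and j: each has a neighbour outside
    -- its own ball.
    obtain ⟨e1, e2, e3⟩ := balls_switch hd ha hb (fun s hs => not_mem_ball_of_adj hbu hab hs)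
      (fun s hs => not_mem_ball_of_adj hau hab.symm hs) hx hy
    simp only [Finset.coe_sigma, Set.mem_sigma_iff, Finset.mem_coe, mem_midGraphs, linkPairs,
      Finset.mem_filter, Finset.mem_product, mem_outDarts, e1, e2]
    refine ⟨⟨hsw.isReg hG, hd, ?_⟩, ⟨⟨ha, hx'.1, hsw.symm.ab⟩, hb, hy'.2, hsw.symm.xy⟩,
      hx'.2, hy'.1, hsw.symm.nax, hsw.symm.nby, hxy.ne⟩
    have hm : (a, b) ∈ midDarts G u v i j := mem_midDarts.2 ⟨ha, hb, hab⟩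
    have : midDarts (switch G a b x y) u v i j = (midDarts G u v i j).erase (a, b) := by
      ext p
      rw [e3, Finset.mem_erase]
      by_cases hp : p = (a, b)
      · simp [hp, hm]
      · simp [hp]
    rw [this, Finset.card_erase_of_mem hm, hc]
    rfl
  · rintro ⟨G, ⟨a, x⟩, ⟨b, y⟩⟩ h
    simp only [Finset.coe_sigma, Set.mem_sigma_iff, Finset.mem_coe, mem_midGraphs, linkPairs,
      Finset.mem_filter, Finset.mem_product, mem_outDarts] at h
    obtain ⟨⟨hG, hd, hc⟩, ⟨⟨ha, hxu, hax⟩, hb, hyv, hby⟩, hxv, hyu, hab, hxy, hne⟩ := h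
    have hau : a ∉ ball G v j := Finset.disjoint_left.1 hd ha
    have hx : x ∉ ball G u i ∪ ball G v j := Finset.notMem_union.2 ⟨hxu, hxv⟩
    have hy : y ∉ ball G u i ∪ ball G v j := Finset.notMem_union.2 ⟨hyu, hyv⟩
    have hsw : Switchable G a x b y := ⟨hax, hby, hab, hxy, fun e => hau (e ▸ hb), hne⟩
    obtain ⟨e1, e2, e3⟩ := balls_switch hd ha hb (fun s hs => not_mem_ball_of_adj hxu hax hs)
      (fun s hs => not_mem_ball_of_adj hyv hby hs) hx hy
    -- The link pair consists of the darts ax, by, so its switching is that of the edges ab, xy with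
    -- the middle vertices exchanged.
    rw [switch_comm] at e1 e2 e3
    simp only [Finset.coe_sigma, Set.mem_sigma_iff, Finset.mem_coe, mem_midGraphs, cutPairs,
      Finset.mem_filter, Finset.mem_univ, true_and, mem_midDarts, e1, e2]
    refine ⟨⟨hsw.isReg hG, hd, ?_⟩, ⟨ha, hb, hsw.symm.ab⟩, hsw.symm.xy, hx, hy, hsw.symm.nax,
      hsw.symm.nby⟩
    have hm : (a, b) ∉ midDarts G u v i j := fun h => hab (mem_midDarts.1 h).2.2
    have : midDarts (switch G a x b y) u v i j = insert (a, b) (midDarts G u v i j) := by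
      ext p
      rw [e3, Finset.mem_insert]
      by_cases hp : p = (a, b)
      · simp [hp, hm]
      · simp [hp]
    rw [this, Finset.card_insert_of_notMem hm, hc]
  · rintro ⟨G, ⟨a, b⟩, ⟨x, y⟩⟩ _
    simp only [switch_comm _ a x b y, switch_switch]
  · rintro ⟨G, ⟨a, b⟩, ⟨x, y⟩⟩ _
    simp only [switch_comm _ a x b y, switch_switch]

lemma card_cutPairs_le {G : SimpleGraph V} {d : ℕ} (hG : IsReg G d) (u v : V) (i j : ℕ) :
    (cutPairs G u v i j).card ≤ (midDarts G u v i j).card * (d * Fintype.card V) := by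
  have h : (Finset.univ.filter fun p : V × V => G.Adj p.1 p.2).card = d * Fintype.card V := by
    simpa using card_shell_darts hG Finset.univ
  rw [← h, ← Finset.card_product]
  refine Finset.card_le_card fun p hp => ?_
  simp only [cutPairs, Finset.mem_filter, Finset.mem_univ, true_and] at hp
  simp [hp.1, hp.2.1]

/-- For each joining edge, the only forbidden darts xy meet the balls or the neighbourhoods of a and
b. -/
lemma le_card_cutPairs {G : SimpleGraph V} {q : ℕ} (hq : 2 ≤ q) (hG : IsReg G (q + 1)) (u v : V)
    (i j : ℕ) : (midDarts G u v i j).card * ((q + 1) * Fintype.card V) ≤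
      (cutPairs G u v i j).card + (midDarts G u v i j).card *
        (2 * (q + 1) * ((q + 1) * q ^ i + (q + 1) * q ^ j) + 2 * (q + 1) ^ 2) := by
  rw [cutPairs, card_filter_mem_prod (midDarts G u v i j) (fun e p : V × V =>
    G.Adj p.1 p.2 ∧ p.1 ∉ ball G u i ∪ ball G v j ∧ p.2 ∉ ball G u i ∪ ball G v j ∧
    ¬ G.Adj e.1 p.1 ∧ ¬ G.Adj e.2 p.2), Finset.card_eq_sum_ones, Finset.sum_mul, Finset.sum_mul,
    ← Finset.sum_add_distrib]
  refine Finset.sum_le_sum fun e _ => ?_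
  rw [one_mul, one_mul]
  refine (card_avoiding_darts hG (ball G u i ∪ ball G v j) e.1 e.2).trans ?_
  gcongr
  exact (Finset.card_union_le _ _).trans
    (Nat.add_le_add (card_ball_le hq hG u i) (card_ball_le hq hG v j))

/-- Pairs of darts leaving the two balls whose outer ends are equal or adjacent. -/
noncomputable def touchingPairs (G : SimpleGraph V) (u v : V) (i j : ℕ) :
    Finset ((V × V) × (V × V)) :=
  (outDarts G u i ×ˢ outDarts G v j).filter fun p => G.Adj p.1.2 p.2.2 ∨ p.1.2 = p.2.2

lemma card_linkPairs_le (G : SimpleGraph V) (u v : V) (i j : ℕ) :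
    (linkPairs G u v i j).card ≤ (outDarts G u i).card * (outDarts G v j).card := by
  rw [← Finset.card_product]
  exact Finset.card_filter_le _ _

/-- A pair of leaving darts ax, by fails to be a link pair only if one of the darts already joins
the balls, if ab is already an edge, or if x and y touch. The first two cases are charged to the
joining edges. -/
lemma le_card_linkPairs {G : SimpleGraph V} {d : ℕ} (hG : IsReg G d) (u v : V) (i j : ℕ) :
    (outDarts G u i).card * (outDarts G v j).card ≤ (linkPairs G u v i j).card +
      (midDarts G u v i j).card * ((outDarts G u i).card + (outDarts G v j).card + d ^ 2) +
      (touchingPairs G u v i j).card := by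
  set M := midDarts G u v i j with hM
  set O := outDarts G u i with hO
  set O' := outDarts G v j with hO'
  set N := M.sigma fun p => (Finset.univ.filter fun w => G.Adj p.1 w) ×ˢ
    (Finset.univ.filter fun w => G.Adj p.2 w) with hN
  have hNc : N.card = M.card * d ^ 2 := by
    rw [hN, Finset.card_sigma, Finset.sum_congr rfl fun p _ => by
      rw [Finset.card_product, hG, hG, ← sq], Finset.sum_const, smul_eq_mul]
  set N' : Finset ((V × V) × (V × V)) := N.image fun p => ((p.1.1, p.2.1), (p.1.2, p.2.2))
  have hN'c : N'.card ≤ M.card * d ^ 2 := hNc ▸ Finset.card_image_le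
  set M' : Finset (V × V) := M.image Prod.swap
  have hM'c : M'.card ≤ M.card := Finset.card_image_le
  rw [← Finset.card_product]
  have hsub : O ×ˢ O' ⊆ ((linkPairs G u v i j ∪ M ×ˢ O') ∪ O ×ˢ M') ∪ N' ∪
      touchingPairs G u v i j := by
    rintro ⟨⟨a, x⟩, ⟨b, y⟩⟩ h
    have h' := h
    rw [Finset.mem_product] at h
    obtain ⟨ha, hx, hax⟩ := mem_outDarts.1 h.1
    obtain ⟨hb, hy, hby⟩ := mem_outDarts.1 h.2
    by_cases c1 : x ∈ ball G v j
    · have : (a, x) ∈ M := mem_midDarts.2 ⟨ha, c1, hax⟩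
      simp only [Finset.mem_union, Finset.mem_product]
      exact Or.inl (Or.inl (Or.inl (Or.inr ⟨this, h.2⟩)))
    by_cases c2 : y ∈ ball G u i
    · have : (b, y) ∈ M' := Finset.mem_image.2 ⟨(y, b), mem_midDarts.2 ⟨c2, hb, hby.symm⟩, rfl⟩
      simp only [Finset.mem_union, Finset.mem_product]
      exact Or.inl (Or.inl (Or.inr ⟨h.1, this⟩))
    by_cases c3 : G.Adj a b
    · have : ((a, x), (b, y)) ∈ N' := by
        refine Finset.mem_image.2 ⟨⟨(a, b), (x, y)⟩, ?_, rfl⟩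
        rw [hN, Finset.mem_sigma]
        refine ⟨mem_midDarts.2 ⟨ha, hb, c3⟩, ?_⟩
        simp only [Finset.mem_product, Finset.mem_filter, Finset.mem_univ, true_and]
        exact ⟨hax, hby⟩
      simp only [Finset.mem_union]
      exact Or.inl (Or.inr this)
    by_cases c4 : G.Adj x y ∨ x = y
    · exact Finset.mem_union_right _ (Finset.mem_filter.2 ⟨h', c4⟩)
    · rw [not_or] at c4
      simp only [Finset.mem_union]
      exact Or.inl (Or.inl (Or.inl (Or.inl (Finset.mem_filter.2 ⟨h', c1, c2, c3, c4.1, c4.2⟩))))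
  have h1 := Finset.card_le_card hsub
  have b1 := Finset.card_union_le (((linkPairs G u v i j ∪ M ×ˢ O') ∪ O ×ˢ M') ∪ N')
    (touchingPairs G u v i j)
  have b2 := Finset.card_union_le ((linkPairs G u v i j ∪ M ×ˢ O') ∪ O ×ˢ M') N'
  have b3 := Finset.card_union_le (linkPairs G u v i j ∪ M ×ˢ O') (O ×ˢ M')
  have b4 := Finset.card_union_le (linkPairs G u v i j) (M ×ˢ O')
  rw [Finset.card_product M O'] at b4
  rw [Finset.card_product O M'] at b3
  have b5 : O.card * M'.card ≤ M.card * O.card := by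
    rw [mul_comm]; exact Nat.mul_le_mul_right _ hM'c
  rw [mul_add, mul_add]
  omega

/-- For fixed `G` and `u` there are few touching pairs on average over `v`. -/
lemma sum_card_touchingPairs_le {G : SimpleGraph V} {q : ℕ} (hq : 2 ≤ q) (hG : IsReg G (q + 1))
    (u : V) (i j : ℕ) : ∑ v, (touchingPairs G u v i j).card ≤
      ((q + 1) * q ^ i) * ((q + 2) * ((q + 1) * ((q + 1) * q ^ j))) := by
  set N := fun v => Finset.univ.filter fun w => G.Adj v w with hN
  have hNc : ∀ v, (N v).card = q + 1 := hG
  -- Encoding of a touching pair ax, by together with v: first the dart ax, then y equal or adjacent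
  -- to x, then b adjacent to y, and finally v in the ball of radius j about b.
  set T := (outDarts G u i).sigma fun p => (insert p.2 (N p.2)).sigma fun y => (N y).sigma
    fun b => ball G b j with hT
  have hTc : T.card ≤ ((q + 1) * q ^ i) * ((q + 2) * ((q + 1) * ((q + 1) * q ^ j))) := by
    rw [hT, Finset.card_sigma]
    refine (Finset.sum_le_card_nsmul _ _ ((q + 2) * ((q + 1) * ((q + 1) * q ^ j)))
      fun p _ => ?_).trans (by rw [smul_eq_mul]; gcongr; exact card_outDarts_le hG u i)
    rw [Finset.card_sigma]
    refine (Finset.sum_le_card_nsmul _ _ ((q + 1) * ((q + 1) * q ^ j)) fun y _ => ?_).trans ?_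
    · rw [Finset.card_sigma]
      refine (Finset.sum_le_card_nsmul _ _ ((q + 1) * q ^ j)
        fun b _ => card_ball_le hq hG b j).trans ?_
      rw [smul_eq_mul, hNc]
    · rw [smul_eq_mul]
      gcongr
      exact (Finset.card_insert_le _ _).trans (by rw [hNc])
  refine le_trans ?_ hTc
  rw [← Finset.card_sigma]
  refine Finset.card_le_card_of_injOn (fun p => ⟨p.2.1, p.2.2.2, p.2.2.1, p.1⟩) ?_ ?_
  · rintro ⟨v, ⟨a, x⟩, ⟨b, y⟩⟩ h
    simp only [Finset.coe_sigma, Set.mem_sigma_iff, Finset.mem_coe, Finset.mem_univ, true_and,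
      touchingPairs, Finset.mem_filter, Finset.mem_product] at h
    obtain ⟨⟨hax, hby⟩, hxy⟩ := h
    rw [mem_outDarts] at hby
    simp only [hT, hN, Finset.coe_sigma, Set.mem_sigma_iff, Finset.mem_coe, Finset.mem_insert,
      Finset.mem_filter, Finset.mem_univ, true_and]
    exact ⟨hax, hxy.symm.imp Eq.symm id, hby.2.2.symm, mem_ball_comm.1 hby.1⟩
  · rintro ⟨v, ⟨a, x⟩, ⟨b, y⟩⟩ _ ⟨v', ⟨a', x'⟩, ⟨b', y'⟩⟩ _ h
    simp only [Sigma.mk.injEq, Prod.mk.injEq, heq_eq_eq] at h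
    obtain ⟨⟨rfl, rfl⟩, rfl, rfl, rfl⟩ := h
    rfl

end
end RandomRegular

/-! ### Geodesics as walks across the middle; averages and deficits -/

namespace RandomRegular
section
open Classical

variable {V : Type*} [Fintype V]

lemma exists_mem_balls_of_mem_ball {G : SimpleGraph V} {u v : V} {i j : ℕ}
    (h : v ∈ ball G u (i + j)) : ∃ w, w ∈ ball G u i ∧ w ∈ ball G v j := by
  induction j generalizing v with
  | zero => exact ⟨v, h, self_mem_ball G v 0⟩
  | succ j ih =>
    rw [← add_assoc, mem_ball_succ] at h
    rcases h with h | ⟨z, hz, hzv⟩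
    · obtain ⟨w, hw, hw'⟩ := ih h
      exact ⟨w, hw, ball_subset_succ _ _ _ hw'⟩
    · obtain ⟨w, hw, hw'⟩ := ih hz
      exact ⟨w, hw, mem_ball_comm.1 (mem_ball_of_adj (mem_ball_comm.1 hw') hzv)⟩

lemma disjoint_balls_iff {G : SimpleGraph V} {u v : V} {i j : ℕ} :
    Disjoint (ball G u i) (ball G v j) ↔ v ∉ ball G u (i + j) := by
  rw [Finset.disjoint_left]
  constructor
  · intro h h'
    obtain ⟨w, hw, hw'⟩ := exists_mem_balls_of_mem_ball h'
    exact h hw hw'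
  · intro h w hw hw'
    exact h (mem_ball_trans hw (mem_ball_comm.1 hw'))

/-- This closes the recursion: the class with no joining edge is the disjointness event at the next
radius. -/
lemma card_midDarts_eq_zero_iff {G : SimpleGraph V} {u v : V} {i j : ℕ} :
    (Disjoint (ball G u i) (ball G v j) ∧ (midDarts G u v i j).card = 0) ↔
      Disjoint (ball G u (i + 1)) (ball G v j) := by
  rw [Finset.card_eq_zero, Finset.eq_empty_iff_forall_notMem]
  constructor
  · rintro ⟨h, h'⟩
    rw [Finset.disjoint_left] at h ⊢
    intro x hx hx'
    rcases mem_ball_succ.1 hx with hx | ⟨a, ha, hax⟩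
    · exact h hx hx'
    · exact h' (a, x) (mem_midDarts.2 ⟨ha, hx', hax⟩)
  · intro h
    refine ⟨Finset.disjoint_of_subset_left (ball_subset_succ _ _ _) h, fun p hp => ?_⟩
    obtain ⟨h1, h2, h3⟩ := mem_midDarts.1 hp
    exact Finset.disjoint_left.1 h (mem_ball_of_adj h1 h3) h2

lemma walkCount_comm (G : SimpleGraph V) (u v : V) (r : ℕ) :
    walkCount G u r v = walkCount G v r u := by
  rw [walkCount, walkCount, ← Matrix.transpose_apply (G.adjMatrix ℕ ^ r), Matrix.transpose_pow,
    SimpleGraph.transpose_adjMatrix]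

/-- Cut each walk at its edge number i + 1; the ends of that edge automatically lie in the two
balls. -/
lemma walkCount_add (G : SimpleGraph V) (u v : V) (i j : ℕ) :
    walkCount G u (i + 1 + j) v =
      ∑ p ∈ midDarts G u v i j, walkCount G u i p.1 * walkCount G v j p.2 := by
  have h : walkCount G u (i + 1 + j) v = ∑ b, walkCount G u (i + 1) b * walkCount G b j v := by
    simp only [walkCount]
    rw [pow_add, Matrix.mul_apply]
  rw [h]
  simp only [walkCount_succ, Finset.sum_mul]
  rw [Finset.sum_comm, ← Fintype.sum_prod_type', ← Finset.sum_subset (Finset.subset_univ _)]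
  · refine Finset.sum_congr rfl fun p hp => ?_
    rw [if_pos (mem_midDarts.1 hp).2.2, walkCount_comm G p.2]
  · intro p _ hp
    by_contra hne
    rw [mul_eq_zero, not_or] at hne
    have hadj : G.Adj p.1 p.2 := by
      by_contra h'
      exact hne.1 (if_neg h')
    rw [if_pos hadj, walkCount_comm G p.2] at hne
    exact hp (mem_midDarts.2 ⟨mem_ball_of_walkCount hne.1, mem_ball_of_walkCount hne.2, hadj⟩)

/-- Disjointness excludes walks of length at most i + j and a joining edge supplies one of length i
+ 1 + j. This is therefore the distance, and walks of that length are automatically paths. -/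
lemma numGeodesics_eq_walkCount {G : SimpleGraph V} {u v : V} {i j : ℕ}
    (hd : Disjoint (ball G u i) (ball G v j)) (hm : (midDarts G u v i j).card ≠ 0) :
    numGeodesics G u v = walkCount G u (i + 1 + j) v := by
  have hlow : ∀ p : G.Walk u v, i + 1 + j ≤ p.length := by
    intro p
    by_contra hp
    exact disjoint_balls_iff.1 hd (mem_ball_iff_walk.2 ⟨p, by omega⟩)
  obtain ⟨⟨a, b⟩, hab⟩ := Finset.card_pos.1 (Nat.pos_of_ne_zero hm)
  obtain ⟨ha, hb, hadj⟩ := mem_midDarts.1 hab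
  obtain ⟨p₀, hp₀⟩ := mem_ball_iff_walk.1
    (mem_ball_trans (mem_ball_of_adj ha hadj) (mem_ball_comm.1 hb))
  have hdist : G.dist u v = i + 1 + j := by
    refine le_antisymm ((SimpleGraph.dist_le p₀).trans hp₀) ?_
    obtain ⟨p, hp⟩ := SimpleGraph.Reachable.exists_walk_length_eq_dist ⟨p₀⟩
    exact hp ▸ hlow p
  have hset : {p : G.Walk u v | IsGeodesic p} = {p : G.Walk u v | p.length = i + 1 + j} := by
    ext p
    constructor
    · rintro ⟨_, hp⟩
      exact le_antisymm ((hp p₀.bypass p₀.bypass_isPath).trans (p₀.length_bypass_le_length.trans hp₀))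
        (hlow p)
    · intro hp
      exact ⟨p.isPath_of_length_eq_dist (hp.trans hdist.symm), fun q _ => hp ▸ hlow q⟩
  rw [numGeodesics, hset, walkCount, SimpleGraph.adjMatrix_pow_apply_eq_card_walk, Nat.cast_id,
    ← Nat.card_coe_set_eq, ← Nat.card_eq_fintype_card]

lemma midDarts_subset_outDarts {G : SimpleGraph V} {u v : V} {i j : ℕ}
    (hd : Disjoint (ball G u i) (ball G v j)) {p : V × V} (hp : p ∈ midDarts G u v i j) :
    p ∈ outDarts G u i ∧ p.swap ∈ outDarts G v j := by
  obtain ⟨h1, h2, h3⟩ := mem_midDarts.1 hp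
  exact ⟨mem_outDarts.2 ⟨h1, Finset.disjoint_right.1 hd h2, h3⟩,
    mem_outDarts.2 ⟨h2, Finset.disjoint_left.1 hd h1, h3.symm⟩⟩

/-- The darts leaving the ball from a vertex reached by more than one walk. -/
noncomputable def multiDarts (G : SimpleGraph V) (u : V) (r : ℕ) : Finset (V × V) :=
  (outDarts G u r).filter fun p => walkCount G u r p.1 ≠ 1

/-- If the number of geodesics differs from the number of darts between the balls, then some dart
between the balls starts or ends at a vertex reached by more than one walk. -/
lemma one_le_of_walkCount_ne {G : SimpleGraph V} {u v : V} {i j : ℕ}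
    (hd : Disjoint (ball G u i) (ball G v j))
    (hne : walkCount G u (i + 1 + j) v ≠ (midDarts G u v i j).card) :
    1 ≤ ((multiDarts G u i).filter fun p => p.2 ∈ ball G v j).card +
      ((multiDarts G v j).filter fun p => p.2 ∈ ball G u i).card := by
  by_contra hlt
  have h1 : ((multiDarts G u i).filter fun p => p.2 ∈ ball G v j).card = 0 := by omega
  have h2 : ((multiDarts G v j).filter fun p => p.2 ∈ ball G u i).card = 0 := by omega
  rw [Finset.card_eq_zero, Finset.eq_empty_iff_forall_notMem] at h1 h2
  apply hne
  rw [walkCount_add, Finset.card_eq_sum_ones]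
  refine Finset.sum_congr rfl fun p hp => ?_
  obtain ⟨ho, ho'⟩ := midDarts_subset_outDarts hd hp
  obtain ⟨ha, hb, -⟩ := mem_midDarts.1 hp
  have e1 : walkCount G u i p.1 = 1 := by
    by_contra h
    exact h1 p (Finset.mem_filter.2 ⟨Finset.mem_filter.2 ⟨ho, h⟩, hb⟩)
  have e2 : walkCount G v j p.2 = 1 := by
    by_contra h
    exact h2 p.swap (Finset.mem_filter.2 ⟨Finset.mem_filter.2 ⟨ho', h⟩, ha⟩)
  rw [e1, e2]

/-- Exchange the sums: for a fixed dart, the admissible v form the ball about its head. -/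
lemma sum_card_filter_mem_ball_le {G : SimpleGraph V} {q : ℕ} (hq : 2 ≤ q)
    (hG : IsReg G (q + 1)) (S : Finset (V × V)) (j : ℕ) :
    ∑ v, (S.filter fun p => p.2 ∈ ball G v j).card ≤ S.card * ((q + 1) * q ^ j) := by
  simp only [Finset.card_filter]
  rw [Finset.sum_comm, ← smul_eq_mul]
  refine Finset.sum_le_card_nsmul _ _ _ fun p _ => ?_
  rw [← Finset.card_filter]
  refine le_trans (Finset.card_le_card fun v hv => ?_) (card_ball_le hq hG p.2 j)
  exact mem_ball_comm.1 (Finset.mem_filter.1 hv).2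

/-- The average of `f` over a uniformly random regular graph and two random vertices. -/
noncomputable def expect (d : ℕ) (f : SimpleGraph V → V → V → ℝ) : ℝ :=
  (∑ G ∈ regGraphs V d, ∑ u, ∑ v, f G u v) /
    ((regGraphs V d).card * (Fintype.card V : ℝ) ^ 2)

/-- The probability of `E` for a uniformly random regular graph and two random vertices. -/
noncomputable def prob (d : ℕ) (E : SimpleGraph V → V → V → Prop) : ℝ :=
  expect d fun G u v => if E G u v then 1 else 0

lemma expect_mono {d : ℕ} {f g : SimpleGraph V → V → V → ℝ}
    (h : ∀ G u v, IsReg G d → f G u v ≤ g G u v) : expect d f ≤ expect d g := by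
  unfold expect
  gcongr with G hG u _ v _
  exact h G u v (mem_regGraphs.1 hG)

lemma expect_add (d : ℕ) (f g : SimpleGraph V → V → V → ℝ) :
    expect d (fun G u v => f G u v + g G u v) = expect d f + expect d g := by
  simp only [expect, Finset.sum_add_distrib, add_div]

lemma expect_const_mul (d : ℕ) (c : ℝ) (f : SimpleGraph V → V → V → ℝ) :
    expect d (fun G u v => c * f G u v) = c * expect d f := by
  simp only [expect, ← Finset.mul_sum, mul_div_assoc]

lemma expect_comm (d : ℕ) (f : SimpleGraph V → V → V → ℝ) :
    expect d (fun G u v => f G v u) = expect d f := by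
  unfold expect
  congr 1
  exact Finset.sum_congr rfl fun G _ => Finset.sum_comm

lemma expect_const [Nonempty V] {d : ℕ} (hne : (regGraphs V d).Nonempty) (c : ℝ) :
    expect d (fun (_ : SimpleGraph V) _ _ => c) = c := by
  have h1 : ((regGraphs V d).card : ℝ) ≠ 0 := by exact_mod_cast hne.card_pos.ne'
  have h2 : (Fintype.card V : ℝ) ≠ 0 := by exact_mod_cast Fintype.card_ne_zero
  simp only [expect, Finset.sum_const, Finset.card_univ, nsmul_eq_mul]
  field_simp

lemma expect_nonneg {d : ℕ} {f : SimpleGraph V → V → V → ℝ} (h : ∀ G u v, 0 ≤ f G u v) :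
    0 ≤ expect d f := by
  unfold expect
  exact div_nonneg (Finset.sum_nonneg fun G _ => Finset.sum_nonneg fun u _ =>
    Finset.sum_nonneg fun v _ => h G u v) (by positivity)

/-- A bound on the sum over the second vertex bounds the average. -/
lemma expect_le_of_sum_le [Nonempty V] {d : ℕ} {f : SimpleGraph V → V → V → ℝ}
    {g : SimpleGraph V → V → ℝ} (h : ∀ G u, IsReg G d → ∑ v, f G u v ≤ g G u) :
    expect d f ≤ expect d (fun G u _ => g G u) / Fintype.card V := by
  have h2 : (Fintype.card V : ℝ) ≠ 0 := by exact_mod_cast Fintype.card_ne_zero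
  have : expect d (fun G u _ => g G u) / Fintype.card V =
      (∑ G ∈ regGraphs V d, ∑ u, g G u) /
      ((regGraphs V d).card * (Fintype.card V : ℝ) ^ 2) := by
    simp only [expect, Finset.sum_const, Finset.card_univ, nsmul_eq_mul, ← Finset.mul_sum]
    field_simp
  rw [this]
  unfold expect
  gcongr with G hG u _
  exact h G u (mem_regGraphs.1 hG)

lemma expect_le_of_sum_graphs_le [Nonempty V] {d : ℕ} (hne : (regGraphs V d).Nonempty)
    {g : SimpleGraph V → V → ℝ} {c : ℝ}
    (h : ∀ u, ∑ G ∈ regGraphs V d, g G u ≤ (regGraphs V d).card * c) :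
    expect d (fun G u _ => g G u) ≤ c := by
  have h1 : (0 : ℝ) < (regGraphs V d).card := by exact_mod_cast hne.card_pos
  have h2 : (0 : ℝ) < Fintype.card V := by exact_mod_cast Fintype.card_pos
  unfold expect
  rw [div_le_iff₀ (by positivity), Finset.sum_comm]
  calc _ ≤ ∑ u : V, (Fintype.card V : ℝ) * ((regGraphs V d).card * c) := by
        refine Finset.sum_le_sum fun u _ => ?_
        simp only [Finset.sum_const, Finset.card_univ, nsmul_eq_mul, ← Finset.mul_sum]
        exact mul_le_mul_of_nonneg_left (h u) h2.le
    _ = _ := by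
        simp only [Finset.sum_const, Finset.card_univ, nsmul_eq_mul]
        ring

lemma prob_mono {d : ℕ} {E F : SimpleGraph V → V → V → Prop}
    (h : ∀ G u v, IsReg G d → E G u v → F G u v) : prob d E ≤ prob d F := by
  refine expect_mono fun G u v hG => ?_
  by_cases hE : E G u v
  · simp [hE, h G u v hG hE]
  · simp only [hE, if_false]
    split_ifs <;> norm_num

lemma prob_nonneg (d : ℕ) (E : SimpleGraph V → V → V → Prop) : 0 ≤ prob d E :=
  expect_nonneg fun G u v => by split_ifs <;> norm_num

lemma prob_le_one [Nonempty V] {d : ℕ} (hne : (regGraphs V d).Nonempty)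
    (E : SimpleGraph V → V → V → Prop) : prob d E ≤ 1 := by
  rw [← expect_const hne 1]
  exact expect_mono fun G u v _ => by split_ifs <;> norm_num

lemma prob_le_add {d : ℕ} {E F H : SimpleGraph V → V → V → Prop}
    (h : ∀ G u v, IsReg G d → E G u v → F G u v ∨ H G u v) :
    prob d E ≤ prob d F + prob d H := by
  rw [prob, prob, prob, ← expect_add]
  refine expect_mono fun G u v hG => ?_
  have := h G u v hG
  split_ifs <;> first | (exfalso; tauto) | norm_num

lemma prob_add_prob_not [Nonempty V] {d : ℕ} (hne : (regGraphs V d).Nonempty)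
    (E : SimpleGraph V → V → V → Prop) :
    prob d E + prob d (fun G u v => ¬ E G u v) = 1 := by
  rw [← expect_const hne 1, prob, prob, ← expect_add]
  congr 1
  ext G u v
  split_ifs <;> norm_num

/-- The shortfall of the number of darts leaving a ball from its tree value. -/
noncomputable def deficit (q : ℕ) (G : SimpleGraph V) (u : V) (r : ℕ) : ℝ :=
  ((q : ℝ) + 1) * q ^ r - (outDarts G u r).card

lemma deficit_nonneg {q : ℕ} {G : SimpleGraph V} (hG : IsReg G (q + 1)) (u : V) (r : ℕ) :
    0 ≤ deficit q G u r := by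
  have : ((outDarts G u r).card : ℝ) ≤ ((q + 1) * q ^ r : ℕ) := by
    exact_mod_cast card_outDarts_le hG u r
  push_cast at this
  rw [deficit]
  linarith

lemma card_multiDarts_le {q : ℕ} {G : SimpleGraph V} (hG : IsReg G (q + 1)) (u : V) (r : ℕ) :
    ((multiDarts G u r).card : ℝ) ≤ deficit q G u r := by
  have : ((multiDarts G u r).card : ℝ) + (outDarts G u r).card ≤ ((q + 1) * q ^ r : ℕ) := by
    exact_mod_cast card_multi_add_card_outDarts_le hG u r
  push_cast at this
  rw [deficit]
  linarith

lemma sum_redundantDarts_le [Nonempty V] {q : ℕ} (hq : 2 ≤ q) (u : V) (t : ℕ)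
    (hn : 4 * ((q + 1) * q ^ t + (q + 1)) ≤ Fintype.card V) :
    (∑ G ∈ regGraphs V (q + 1), ((redundantDarts G u t).card : ℝ)) ≤
      (regGraphs V (q + 1)).card * (2 * ((q : ℝ) + 1) ^ 3 * q ^ (2 * t) / Fintype.card V) := by
  have h := sum_redundantDarts_mul_le (V := V) hq u t
  have h' : ((∑ G ∈ regGraphs V (q + 1), (redundantDarts G u t).card : ℕ) : ℝ) *
      (((q + 1) : ℝ) * Fintype.card V) ≤ (regGraphs V (q + 1)).card *
        (((q : ℝ) + 1) * ((q + 1) * q ^ t)) ^ 2 +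
      ((∑ G ∈ regGraphs V (q + 1), (redundantDarts G u t).card : ℕ) : ℝ) *
        (2 * ((q : ℝ) + 1) * ((q + 1) * q ^ t) + 2 * (q + 1) ^ 2) := by exact_mod_cast h
  have hn' : 4 * (((q : ℝ) + 1) * q ^ t + (q + 1)) ≤ Fintype.card V := by exact_mod_cast hn
  have h2 : (0 : ℝ) < Fintype.card V := by exact_mod_cast Fintype.card_pos
  rw [← Nat.cast_sum]
  set S : ℝ := ((∑ G ∈ regGraphs V (q + 1), (redundantDarts G u t).card : ℕ) : ℝ)
  have hS : 0 ≤ S := Nat.cast_nonneg _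
  set n : ℝ := (Fintype.card V : ℝ)
  -- The size condition makes the excluded darts at most half of all darts, so their contribution is
  -- absorbed on the left.
  have h3 : S * (2 * ((q : ℝ) + 1) * ((q + 1) * q ^ t) + 2 * (q + 1) ^ 2) ≤
      S * ((q + 1) * n / 2) := by
    refine mul_le_mul_of_nonneg_left ?_ hS
    nlinarith [mul_le_mul_of_nonneg_left hn' (by positivity : (0 : ℝ) ≤ (q + 1) / 2)]
  have h4 : S * ((q + 1) * n / 2) ≤ (regGraphs V (q + 1)).card *
        (((q : ℝ) + 1) * ((q + 1) * q ^ t)) ^ 2 := by linarith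
  have h5 : S ≤ ((regGraphs V (q + 1)).card * (((q : ℝ) + 1) * ((q + 1) * q ^ t)) ^ 2) /
      ((q + 1) * n / 2) := by
    rw [le_div_iff₀ (by positivity)]
    exact h4
  refine h5.trans (le_of_eq ?_)
  field_simp
  ring

/-- A deficit is inherited with factor q per level, while the bound on fresh redundancy grows by q^2
per level, so the latter sets the order. The constant 4 closes the induction because 2 + q ≤ 2q. -/
lemma sum_deficit_le [Nonempty V] {q : ℕ} (hq : 2 ≤ q) (u : V) (i : ℕ)
    (hn : 4 * ((q + 1) * q ^ i + (q + 1)) ≤ Fintype.card V) :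
    (∑ G ∈ regGraphs V (q + 1), deficit q G u i) ≤
      (regGraphs V (q + 1)).card * (4 * ((q : ℝ) + 1) ^ 4 * q ^ (2 * i) / Fintype.card V) := by
  have h2 : (0 : ℝ) < Fintype.card V := by exact_mod_cast Fintype.card_pos
  have hq' : (2 : ℝ) ≤ q := by exact_mod_cast hq
  induction i with
  | zero =>
    rw [Finset.sum_eq_zero]
    · positivity
    · intro G hG
      simp [deficit, card_outDarts_zero (mem_regGraphs.1 hG)]
  | succ i ih =>
    have ih' := ih (by
      refine le_trans ?_ hn
      gcongr 4 * ((q + 1) * ?_ + (q + 1))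
      exact Nat.pow_le_pow_right (by omega) (by omega))
    have hr := sum_redundantDarts_le hq u (i + 1) hn
    set N : ℝ := ((regGraphs V (q + 1)).card : ℝ)
    set n : ℝ := (Fintype.card V : ℝ)
    calc ∑ G ∈ regGraphs V (q + 1), deficit q G u (i + 1)
        ≤ ∑ G ∈ regGraphs V (q + 1), (q * deficit q G u i +
          (q + 1) * ((redundantDarts G u (i + 1)).card : ℝ)) := by
          refine Finset.sum_le_sum fun G hG => ?_
          have h : (q : ℝ) * (outDarts G u i).card ≤ (outDarts G u (i + 1)).card +
              (q + 1) * (redundantDarts G u (i + 1)).card := by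
            exact_mod_cast mul_card_outDarts_le (mem_regGraphs.1 hG) u i
          rw [deficit, deficit, pow_succ]
          linarith
      _ = q * ∑ G ∈ regGraphs V (q + 1), deficit q G u i +
          (q + 1) * ∑ G ∈ regGraphs V (q + 1), ((redundantDarts G u (i + 1)).card : ℝ) := by
          rw [Finset.sum_add_distrib, Finset.mul_sum, Finset.mul_sum]
      _ ≤ q * (N * (4 * ((q : ℝ) + 1) ^ 4 * q ^ (2 * i) / n)) +
          (q + 1) * (N * (2 * ((q : ℝ) + 1) ^ 3 * q ^ (2 * (i + 1)) / n)) := by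
          gcongr
      _ = N * (2 * ((q : ℝ) + 1) ^ 4 / n * (q ^ (2 * i) * (q * (2 + q)))) := by
          rw [mul_add 2 i 1, pow_add]
          ring
      _ ≤ N * (2 * ((q : ℝ) + 1) ^ 4 / n * (q ^ (2 * i) * (q * (q + q)))) := by
          gcongr
      _ = _ := by
          rw [mul_add 2 i 1, pow_add]
          ring

end
end RandomRegular

/-! ### Ratios of consecutive probabilities, with explicit errors -/

namespace RandomRegular
section
open Classical

variable {V : Type*} [Fintype V] [Nonempty V]

/-- The two balls are disjoint. -/
def Far (i j : ℕ) (G : SimpleGraph V) (u v : V) : Prop :=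
  Disjoint (ball G u i) (ball G v j)

/-- The two balls are disjoint and joined by exactly `l` edges. -/
def Linked (i j l : ℕ) (G : SimpleGraph V) (u v : V) : Prop :=
  Far i j G u v ∧ (midDarts G u v i j).card = l

/-- Bound for the average deficit of a ball of radius `i`. -/
noncomputable def deficitBound (q n i : ℕ) : ℝ := 4 * ((q : ℝ) + 1) ^ 4 * q ^ (2 * i) / n

lemma expect_deficit_le {q : ℕ} (hq : 2 ≤ q) (hne : (regGraphs V (q + 1)).Nonempty) (i : ℕ)
    (hn : 4 * ((q + 1) * q ^ i + (q + 1)) ≤ Fintype.card V) :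
    expect (q + 1) (fun (G : SimpleGraph V) u _ => deficit q G u i) ≤
      deficitBound q (Fintype.card V) i :=
  expect_le_of_sum_graphs_le hne fun u => sum_deficit_le hq u i hn

lemma prob_not_far_le {q : ℕ} (hq : 2 ≤ q) (hne : (regGraphs V (q + 1)).Nonempty) (i j : ℕ) :
    prob (q + 1) (fun (G : SimpleGraph V) u v => ¬ Far i j G u v) ≤
      ((q : ℝ) + 1) * q ^ (i + j) / Fintype.card V := by
  refine (expect_le_of_sum_le (g := fun _ _ => ((q : ℝ) + 1) * q ^ (i + j)) ?_).trans
    (by rw [expect_const hne])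
  intro G u hG
  have := card_ball_le hq hG u (i + j)
  have e : (Finset.univ.filter fun v => v ∈ ball G u (i + j)) = ball G u (i + j) := by
    ext; simp
  calc _ = ∑ v, (if v ∈ ball G u (i + j) then (1 : ℝ) else 0) :=
        Finset.sum_congr rfl fun v _ => by
          have h : Far i j G u v ↔ v ∉ ball G u (i + j) := disjoint_balls_iff
          by_cases hv : v ∈ ball G u (i + j) <;> simp [h, hv]
    _ ≤ _ := by
        rw [Finset.sum_boole, e]
        exact_mod_cast this

/-- Markov's inequality for the number of darts leaving the first ball with head in the second. The
decay in K supplies the tail control that ratio estimates at fixed l cannot give. -/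
lemma prob_far_card_ge_le {q : ℕ} (hq : 2 ≤ q) (hne : (regGraphs V (q + 1)).Nonempty) (i j : ℕ)
    {K : ℕ} (hK : 0 < K) :
    prob (q + 1) (fun (G : SimpleGraph V) u v => Far i j G u v ∧ K ≤ (midDarts G u v i j).card) ≤
      ((q : ℝ) + 1) ^ 2 * q ^ (i + j) / Fintype.card V / K := by
  have hK' : (0 : ℝ) < K := by exact_mod_cast hK
  rw [le_div_iff₀ hK', mul_comm, prob, ← expect_const_mul]
  refine (expect_le_of_sum_le (g := fun _ _ => ((q : ℝ) + 1) ^ 2 * q ^ (i + j)) ?_).trans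
    (by rw [expect_const hne])
  intro G u hG
  refine (Finset.sum_le_sum (g := fun v =>
    (((outDarts G u i).filter fun p => p.2 ∈ ball G v j).card : ℝ)) fun v _ => ?_).trans ?_
  · split_ifs with hc
    · rw [mul_one, Nat.cast_le]
      refine hc.2.trans (Finset.card_le_card fun p hp => Finset.mem_filter.2 ⟨?_, ?_⟩)
      · exact (midDarts_subset_outDarts hc.1 hp).1
      · exact (mem_midDarts.1 hp).2.1
    · rw [mul_zero]
      exact Nat.cast_nonneg _
  rw [← Nat.cast_sum]
  have h1 := (sum_card_filter_mem_ball_le hq hG (outDarts G u i) j).trans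
    (Nat.mul_le_mul_right _ (card_outDarts_le hG u i))
  calc _ ≤ (((q + 1) * q ^ i * ((q + 1) * q ^ j) : ℕ) : ℝ) := Nat.cast_le.2 h1
    _ = _ := by push_cast; ring

/-- First moment: the expected number of multiply reached boundary darts is at most the mean
deficit, and each has its head in the ball about a random vertex with probability at most (q +
1)q^j/n, or the same with i. -/
lemma prob_walkCount_ne_le {q : ℕ} (hq : 2 ≤ q) (hne : (regGraphs V (q + 1)).Nonempty) (i j : ℕ)
    (hi : 4 * ((q + 1) * q ^ i + (q + 1)) ≤ Fintype.card V)
    (hj : 4 * ((q + 1) * q ^ j + (q + 1)) ≤ Fintype.card V) :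
    prob (q + 1) (fun (G : SimpleGraph V) u v => Far i j G u v ∧
        walkCount G u (i + 1 + j) v ≠ (midDarts G u v i j).card) ≤
      ((q : ℝ) + 1) * q ^ j * deficitBound q (Fintype.card V) i / Fintype.card V +
      ((q : ℝ) + 1) * q ^ i * deficitBound q (Fintype.card V) j / Fintype.card V := by
  have key : ∀ i j : ℕ, 4 * ((q + 1) * q ^ i + (q + 1)) ≤ Fintype.card V →
      expect (q + 1) (fun (G : SimpleGraph V) u v =>
        (((multiDarts G u i).filter fun p => p.2 ∈ ball G v j).card : ℝ)) ≤
      ((q : ℝ) + 1) * q ^ j * deficitBound q (Fintype.card V) i / Fintype.card V := by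
    intro i j hi
    refine (expect_le_of_sum_le (g := fun G u => ((q : ℝ) + 1) * q ^ j * deficit q G u i) ?_).trans
      ?_
    · intro G u hG
      rw [← Nat.cast_sum]
      calc _ ≤ (((multiDarts G u i).card * ((q + 1) * q ^ j) : ℕ) : ℝ) :=
            Nat.cast_le.2 (sum_card_filter_mem_ball_le hq hG _ j)
        _ = ((q : ℝ) + 1) * q ^ j * (multiDarts G u i).card := by push_cast; ring
        _ ≤ _ := mul_le_mul_of_nonneg_left (card_multiDarts_le hG u i) (by positivity)
    · rw [expect_const_mul (q + 1) _ (fun (G : SimpleGraph V) u _ => deficit q G u i)]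
      gcongr
      exact expect_deficit_le hq hne i hi
  refine le_trans ?_ (add_le_add (key i j hi) (key j i hj))
  rw [← expect_comm (q + 1) (fun (G : SimpleGraph V) u v =>
        (((multiDarts G u j).filter fun p => p.2 ∈ ball G v i).card : ℝ)), ← expect_add]
  refine expect_mono fun G u v hG => ?_
  split_ifs with hc
  · exact_mod_cast one_le_of_walkCount_ne hc.1 hc.2
  · positivity

lemma expect_linked_eq (d i j l : ℕ) (f : SimpleGraph V → V → V → ℝ) :
    expect d (fun G u v => if Linked i j l G u v then f G u v else 0) =
    (∑ u : V, ∑ v, ∑ G ∈ midGraphs d u v i j l, f G u v) /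
      ((regGraphs V d).card * (Fintype.card V : ℝ) ^ 2) := by
  rw [expect]
  congr 1
  rw [Finset.sum_comm (s := regGraphs V d)]
  refine Finset.sum_congr rfl fun u _ => ?_
  rw [Finset.sum_comm (s := regGraphs V d)]
  refine Finset.sum_congr rfl fun v _ => ?_
  rw [midGraphs, Finset.sum_filter]
  exact Finset.sum_congr rfl fun G _ => if_congr Iff.rfl rfl rfl

/-- Switching, averaged over both vertices. -/
lemma expect_cutPairs_eq (d i j l : ℕ) :
    expect d (fun (G : SimpleGraph V) u v =>
      if Linked i j (l + 1) G u v then ((cutPairs G u v i j).card : ℝ) else 0) =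
    expect d (fun (G : SimpleGraph V) u v =>
      if Linked i j l G u v then ((linkPairs G u v i j).card : ℝ) else 0) := by
  rw [expect_linked_eq, expect_linked_eq]
  congr 1
  refine Finset.sum_congr rfl fun u _ => Finset.sum_congr rfl fun v _ => ?_
  exact_mod_cast sum_card_cutPairs d u v i j l

lemma expect_ite_const (d : ℕ) (c : ℝ) (E : SimpleGraph V → V → V → Prop) :
    expect d (fun G u v => if E G u v then c else 0) = c * prob d E := by
  rw [prob, ← expect_const_mul]
  congr 1
  ext G u v
  simp

lemma expect_cutPairs_le (d i j l : ℕ) :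
    expect d (fun (G : SimpleGraph V) u v =>
      if Linked i j l G u v then ((cutPairs G u v i j).card : ℝ) else 0) ≤
    l * (d * Fintype.card V) * prob d (Linked (V := V) i j l) := by
  rw [← expect_ite_const]
  refine expect_mono fun G u v hG => ?_
  split_ifs with hc
  · rw [← hc.2]
    exact_mod_cast card_cutPairs_le hG u v i j
  · exact le_rfl

lemma le_expect_cutPairs {q : ℕ} (hq : 2 ≤ q) (i j l : ℕ) :
    l * (((q : ℝ) + 1) * Fintype.card V) * prob (q + 1) (Linked (V := V) i j l) ≤
    expect (q + 1) (fun (G : SimpleGraph V) u v =>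
      if Linked i j l G u v then ((cutPairs G u v i j).card : ℝ) else 0) +
    l * (2 * ((q : ℝ) + 1) * ((q + 1) * q ^ i + (q + 1) * q ^ j) + 2 * (q + 1) ^ 2) *
      prob (q + 1) (Linked (V := V) i j l) := by
  rw [← expect_ite_const, ← expect_ite_const, ← expect_add]
  refine expect_mono fun G u v hG => ?_
  split_ifs with hc
  · have := le_card_cutPairs hq hG u v i j
    rw [hc.2] at this
    exact_mod_cast this
  · simp

lemma expect_linkPairs_le {q : ℕ} (i j l : ℕ) :
    expect (q + 1) (fun (G : SimpleGraph V) u v =>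
      if Linked i j l G u v then ((linkPairs G u v i j).card : ℝ) else 0) ≤
    ((q : ℝ) + 1) ^ 2 * q ^ (i + j) * prob (q + 1) (Linked (V := V) i j l) := by
  rw [← expect_ite_const]
  refine expect_mono fun G u v hG => ?_
  split_ifs with hc
  · have h := (card_linkPairs_le G u v i j).trans
      (Nat.mul_le_mul (card_outDarts_le hG u i) (card_outDarts_le hG v j))
    calc _ ≤ (((q + 1) * q ^ i * ((q + 1) * q ^ j) : ℕ) : ℝ) := Nat.cast_le.2 h
      _ = _ := by push_cast; ring
  · exact le_rfl

lemma expect_touchingPairs_le {q : ℕ} (hq : 2 ≤ q) (hne : (regGraphs V (q + 1)).Nonempty)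
    (i j : ℕ) : expect (q + 1) (fun (G : SimpleGraph V) u v =>
      ((touchingPairs G u v i j).card : ℝ)) ≤
      ((q : ℝ) + 1) ^ 3 * (q + 2) * q ^ (i + j) / Fintype.card V := by
  refine (expect_le_of_sum_le (g := fun _ _ => ((q : ℝ) + 1) ^ 3 * (q + 2) * q ^ (i + j)) ?_).trans
    (by rw [expect_const hne])
  intro G u hG
  rw [← Nat.cast_sum]
  refine (Nat.cast_le.2 (sum_card_touchingPairs_le hq hG u i j)).trans (le_of_eq ?_)
  push_cast
  ring

/-- The loss in the lower bound for the number of link pairs. -/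
noncomputable def linkError (q n i j l : ℕ) : ℝ :=
  ((q : ℝ) + 1) * q ^ j * deficitBound q n i + ((q : ℝ) + 1) * q ^ i * deficitBound q n j +
    l * (((q : ℝ) + 1) * q ^ i + (q + 1) * q ^ j + (q + 1) ^ 2) +
    ((q : ℝ) + 1) ^ 3 * (q + 2) * q ^ (i + j) / n

lemma le_expect_linkPairs {q : ℕ} (hq : 2 ≤ q) (hne : (regGraphs V (q + 1)).Nonempty) (i j l : ℕ)
    (hi : 4 * ((q + 1) * q ^ i + (q + 1)) ≤ Fintype.card V)
    (hj : 4 * ((q + 1) * q ^ j + (q + 1)) ≤ Fintype.card V) :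
    ((q : ℝ) + 1) ^ 2 * q ^ (i + j) * prob (q + 1) (Linked (V := V) i j l) ≤
    expect (q + 1) (fun (G : SimpleGraph V) u v =>
      if Linked i j l G u v then ((linkPairs G u v i j).card : ℝ) else 0) +
    linkError q (Fintype.card V) i j l := by
  set c : ℝ := l * (((q : ℝ) + 1) * q ^ i + (q + 1) * q ^ j + (q + 1) ^ 2)
  have hc0 : 0 ≤ c := by positivity
  have h1 : ((q : ℝ) + 1) ^ 2 * q ^ (i + j) * prob (q + 1) (Linked (V := V) i j l) ≤
      expect (q + 1) (fun (G : SimpleGraph V) u v =>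
        (((((if Linked i j l G u v then ((linkPairs G u v i j).card : ℝ) else 0) +
        ((q : ℝ) + 1) * q ^ j * deficit q G u i) + ((q : ℝ) + 1) * q ^ i * deficit q G v j) + c) +
        ((touchingPairs G u v i j).card : ℝ))) := by
    rw [← expect_ite_const]
    refine expect_mono fun G u v hG => ?_
    have d1 := deficit_nonneg hG u i
    have d2 := deficit_nonneg hG v j
    split_ifs with hL
    · have h : ((outDarts G u i).card : ℝ) * (outDarts G v j).card ≤ (linkPairs G u v i j).card +
          l * ((outDarts G u i).card + (outDarts G v j).card + (q + 1) ^ 2) +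
          (touchingPairs G u v i j).card := by
        have := le_card_linkPairs hG u v i j
        rw [hL.2] at this
        exact_mod_cast this
      have o1 : ((outDarts G u i).card : ℝ) ≤ (q + 1) * q ^ i := by
        exact_mod_cast card_outDarts_le hG u i
      have o2 : ((outDarts G v j).card : ℝ) ≤ (q + 1) * q ^ j := by
        exact_mod_cast card_outDarts_le hG v j
      have h3 : (l : ℝ) * ((outDarts G u i).card + (outDarts G v j).card + (q + 1) ^ 2) ≤ c := by
        simp only [c]
        gcongr
      -- Expand the product of two numbers that fall short of their tree values by the deficits; the
      -- product of the deficits is dropped.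
      have h4 : ((q : ℝ) + 1) ^ 2 * q ^ (i + j) ≤ ((outDarts G u i).card : ℝ) *
          (outDarts G v j).card + ((q : ℝ) + 1) * q ^ j * deficit q G u i +
          ((q : ℝ) + 1) * q ^ i * deficit q G v j := by
        have e : ((q : ℝ) + 1) ^ 2 * q ^ (i + j) = ((q + 1) * q ^ i) * ((q + 1) * q ^ j) := by ring
        have e1 : deficit q G u i = (q + 1) * q ^ i - (outDarts G u i).card := rfl
        have e2 : deficit q G v j = (q + 1) * q ^ j - (outDarts G v j).card := rfl
        rw [e]
        nlinarith [mul_nonneg d1 d2]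
      linarith
    · positivity
  refine h1.trans ?_
  rw [expect_add, expect_add, expect_add, expect_add, expect_const hne,
    expect_const_mul (q + 1) _ (fun (G : SimpleGraph V) u _ => deficit q G u i),
    expect_const_mul (q + 1) _ (fun (G : SimpleGraph V) _ v => deficit q G v j),
    expect_comm (q + 1) (fun (G : SimpleGraph V) u _ => deficit q G u j)]
  have e1 := mul_le_mul_of_nonneg_left (expect_deficit_le hq hne i hi)
    (by positivity : (0 : ℝ) ≤ (q + 1) * q ^ j)
  have e2 := mul_le_mul_of_nonneg_left (expect_deficit_le hq hne j hj)
    (by positivity : (0 : ℝ) ≤ (q + 1) * q ^ i)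
  have e3 := expect_touchingPairs_le (V := V) hq hne i j
  rw [linkError]
  linarith

/-- The ratio of consecutive probabilities, up to explicit errors. -/
lemma abs_linked_ratio_le {q : ℕ} (hq : 2 ≤ q) (hne : (regGraphs V (q + 1)).Nonempty)
    (i j l : ℕ) (hi : 4 * ((q + 1) * q ^ i + (q + 1)) ≤ Fintype.card V)
    (hj : 4 * ((q + 1) * q ^ j + (q + 1)) ≤ Fintype.card V) :
    |((l : ℝ) + 1) * prob (q + 1) (Linked (V := V) i j (l + 1)) -
      ((q : ℝ) + 1) * q ^ (i + j) / Fintype.card V * prob (q + 1) (Linked (V := V) i j l)| ≤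
    (linkError q (Fintype.card V) i j l + ((l : ℝ) + 1) *
      (2 * ((q : ℝ) + 1) * ((q + 1) * q ^ i + (q + 1) * q ^ j) + 2 * (q + 1) ^ 2)) /
      ((q + 1) * Fintype.card V) := by
  have hn : (0 : ℝ) < Fintype.card V := by exact_mod_cast Fintype.card_pos
  set n : ℝ := (Fintype.card V : ℝ) with hn'
  set a := prob (q + 1) (Linked (V := V) i j l) with ha
  set b := prob (q + 1) (Linked (V := V) i j (l + 1)) with hb
  set E := 2 * ((q : ℝ) + 1) * ((q + 1) * q ^ i + (q + 1) * q ^ j) + 2 * (q + 1) ^ 2 with hE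
  have b1 : b ≤ 1 := prob_le_one hne _
  have b0 : 0 ≤ b := prob_nonneg _ _
  have hE0 : 0 ≤ E := by positivity
  have h1 := expect_cutPairs_le (V := V) (q + 1) i j (l + 1)
  have h2 := le_expect_cutPairs (V := V) hq i j (l + 1)
  have h3 := expect_linkPairs_le (V := V) (q := q) i j l
  have h4 := le_expect_linkPairs hq hne i j l hi hj
  -- Now the cut-pair bounds for class l + 1 and the link-pair bounds for class l estimate the same
  -- average `X`.
  rw [expect_cutPairs_eq] at h1 h2
  push_cast at h1 h2
  rw [← hn', ← ha, ← hb] at *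
  set X := expect (q + 1) (fun (G : SimpleGraph V) u v =>
      if Linked i j l G u v then ((linkPairs G u v i j).card : ℝ) else 0)
  have hle : 0 ≤ linkError q (Fintype.card V) i j l := by
    unfold linkError deficitBound
    positivity
  have h5 : ((l : ℝ) + 1) * E * b ≤ (l + 1) * E := by
    have : 0 ≤ ((l : ℝ) + 1) * E := by positivity
    nlinarith
  have h6 : 0 ≤ ((l : ℝ) + 1) * E := by positivity
  have e : ((l : ℝ) + 1) * b - ((q : ℝ) + 1) * q ^ (i + j) / n * a =
      ((l + 1) * ((q + 1) * n) * b - (q + 1) ^ 2 * q ^ (i + j) * a) / ((q + 1) * n) := by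
    field_simp
  rw [e, abs_div, abs_of_pos (by positivity : 0 < ((q : ℝ) + 1) * n)]
  gcongr
  rw [abs_le]
  constructor <;> linarith

end
end RandomRegular

/-! ### Existence of regular graphs; decomposition by distance -/

namespace RandomRegular
section
open Classical

/-- A symmetric set of residues of prescribed size. -/
lemma exists_symmetric_finset {N d : ℕ} (hd : d ≤ N) (he : Even (d * (N + 1))) :
    ∃ S : Finset (Fin (N + 1)), S.card = d ∧ 0 ∉ S ∧ ∀ x ∈ S, -x ∈ S := by
  set k := d / 2 with hk
  -- Take k residues on each side of 0 and, for odd d, the self-inverse residue (N + 1)/2, which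
  -- exists because N + 1 is then even.
  set S : Finset (Fin (N + 1)) := Finset.univ.filter fun x => (1 ≤ x.val ∧ x.val ≤ k) ∨
    (N + 1 - k ≤ x.val) ∨ (d % 2 = 1 ∧ 2 * x.val = N + 1) with hS
  have hpar : d % 2 = 1 → (N + 1) % 2 = 0 := by
    intro h
    rcases Nat.even_mul.1 he with h' | h'
    · rw [Nat.even_iff] at h'
      omega
    · exact Nat.even_iff.1 h'
  refine ⟨S, ?_, ?_, ?_⟩
  · have hmap : S.map Fin.valEmbedding = (Finset.Icc 1 k ∪ Finset.Ico (N + 1 - k) (N + 1)) ∪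
        (if d % 2 = 1 then {(N + 1) / 2} else ∅) := by
      ext y
      simp only [hS, Finset.mem_map, Finset.mem_filter, Finset.mem_univ, true_and,
        Fin.valEmbedding_apply, Finset.mem_union, Finset.mem_Icc, Finset.mem_Ico]
      constructor
      · rintro ⟨x, hx, rfl⟩
        have := x.isLt
        split_ifs with h
        · rw [Finset.mem_singleton]
          omega
        · simp only [Finset.notMem_empty, or_false]
          omega
      · intro hy
        split_ifs at hy with h
        · rw [Finset.mem_singleton] at hy
          have := hpar h
          exact ⟨⟨y, by omega⟩, by simp only; omega, rfl⟩
        · simp only [Finset.notMem_empty, or_false] at hy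
          exact ⟨⟨y, by omega⟩, by simp only; omega, rfl⟩
    have hc := congrArg Finset.card hmap
    rw [Finset.card_map, Finset.card_union_of_disjoint, Finset.card_union_of_disjoint] at hc
    · rw [hc]
      split_ifs with h <;> simp <;> omega
    · rw [Finset.disjoint_left]
      intro y hy hy'
      rw [Finset.mem_Icc] at hy
      rw [Finset.mem_Ico] at hy'
      omega
    · rw [Finset.disjoint_left]
      intro y hy hy'
      rw [Finset.mem_union, Finset.mem_Icc, Finset.mem_Ico] at hy
      split_ifs at hy' with h
      · rw [Finset.mem_singleton] at hy'
        have := hpar h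
        omega
      · simp at hy'
  · simp only [hS, Finset.mem_filter, Finset.mem_univ, true_and, Fin.val_zero]
    omega
  · intro x hx
    simp only [hS, Finset.mem_filter, Finset.mem_univ, true_and] at hx ⊢
    have hlt := x.isLt
    have hx0 : x.val ≠ 0 := by omega
    have hneg : (-x).val = N + 1 - x.val := by
      rw [Fin.val_neg, if_neg]
      intro h
      exact hx0 (by simp [h])
    rw [hneg]
    omega

/-- A circulant graph on a symmetric set of d residues. Without existence the probabilities would be
quotients by zero. -/
lemma regGraphs_nonempty {n d : ℕ} (hd : d + 1 ≤ n) (he : Even (d * n)) :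
    (regGraphs (Fin n) d).Nonempty := by
  obtain ⟨N, rfl⟩ : ∃ N, n = N + 1 := ⟨n - 1, by omega⟩
  obtain ⟨S, hc, h0, hs⟩ := exists_symmetric_finset (by omega : d ≤ N) he
  let G : SimpleGraph (Fin (N + 1)) :=
    { Adj := fun a b => b - a ∈ S
      symm := ⟨fun a b h => by
        have := hs _ h
        rwa [neg_sub] at this⟩
      loopless := ⟨fun a h => h0 (by rwa [sub_self] at h)⟩ }
  refine ⟨G, mem_regGraphs.2 fun a => ?_⟩
  rw [← hc]
  refine Finset.card_nbij' (fun b => b - a) (fun x => x + a) ?_ ?_ ?_ ?_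
  · intro b hb
    simpa [G] using hb
  · intro x hx
    simpa [G] using hx
  · intro b _
    simp
  · intro x _
    simp

lemma mem_regularGraphs_iff {n d : ℕ} {G : SimpleGraph (Fin n)} :
    G ∈ regularGraphs n d ↔ G ∈ regGraphs (Fin n) d := by
  rw [mem_regGraphs, regularGraphs, Set.mem_ofPred_eq, SimpleGraph.IsRegularOfDegree, IsReg]
  refine forall_congr' fun v => ?_
  rw [← SimpleGraph.card_neighborFinset_eq_degree, SimpleGraph.neighborFinset_eq_filter]

lemma randomRegularProb_eq (n d : ℕ) (A : SimpleGraph (Fin n) → Fin n → Fin n → Prop) :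
    randomRegularProb n d A = prob d A := by
  have h1 : regularGraphs n d = (regGraphs (Fin n) d : Set (SimpleGraph (Fin n))) := by
    ext G
    exact mem_regularGraphs_iff
  have h2 : {x : SimpleGraph (Fin n) × Fin n × Fin n |
      x.1 ∈ regularGraphs n d ∧ A x.1 x.2.1 x.2.2} =
      ((Finset.univ.filter fun x : SimpleGraph (Fin n) × Fin n × Fin n =>
        x.1 ∈ regGraphs (Fin n) d ∧ A x.1 x.2.1 x.2.2 : Finset _) : Set _) := by
    ext x
    simp [mem_regularGraphs_iff]
  rw [randomRegularProb, h2, h1, Set.ncard_coe_finset, Set.ncard_coe_finset, prob, expect,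
    Fintype.card_fin, card_filter_mem_prod (regGraphs (Fin n) d)
      (fun (G : SimpleGraph (Fin n)) (p : Fin n × Fin n) => A G p.1 p.2)]
  congr 1
  push_cast
  refine Finset.sum_congr rfl fun G _ => ?_
  rw [Finset.card_filter, Fintype.sum_prod_type]
  push_cast
  rfl

variable {V : Type*} [Fintype V] [Nonempty V]

lemma prob_linked_zero (d i j : ℕ) :
    prob d (Linked (V := V) i j 0) = prob d (Far (V := V) (i + 1) j) :=
  le_antisymm (prob_mono fun _ _ _ _ h => card_midDarts_eq_zero_iff.1 h)
    (prob_mono fun _ _ _ _ h => card_midDarts_eq_zero_iff.2 h)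

lemma prob_far_eq_sum (d i j K : ℕ) : prob d (Far (V := V) i j) =
    ∑ l ∈ Finset.range K, prob d (Linked (V := V) i j l) +
      prob d (fun (G : SimpleGraph V) u v => Far i j G u v ∧ K ≤ (midDarts G u v i j).card) := by
  induction K with
  | zero => simp
  | succ K ih =>
    rw [ih, Finset.sum_range_succ, add_assoc]
    congr 1
    rw [prob, prob, prob, ← expect_add]
    congr 1
    ext G u v
    by_cases hF : Far i j G u v
    · rcases lt_trichotomy (midDarts G u v i j).card K with h | h | h
      · simp [Linked, hF, h.ne, not_le.2 h, not_lt.2 h.le]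
      · simp [Linked, hF, h]
      · simp [Linked, hF, h.ne', h.le, h]
    · simp [Linked, hF]

/-- Read A as having l geodesics, F and F' as disjointness at successive radii, L as having l
joining edges, and W as the walk count being the number of joining edges. On F without F', the
events A and L differ only where W fails. -/
lemma indicator_step {A F F' L W : Prop} (h1 : F' → F) (h2 : L → F ∧ ¬ F')
    (h3 : F → ¬ F' → W → (A ↔ L)) :
    ((if A ∧ F' then (1 : ℝ) else 0) + (if L then 1 else 0) ≤
      (if A ∧ F then 1 else 0) + if F ∧ ¬ W then 1 else 0) ∧
    ((if A ∧ F then (1 : ℝ) else 0) ≤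
      (if A ∧ F' then 1 else 0) + (if L then 1 else 0) + if F ∧ ¬ W then 1 else 0) := by
  by_cases F <;> by_cases F' <;> by_cases L <;> by_cases W <;> by_cases A <;> simp_all

/-- One step of the decomposition of the event of having `l` geodesics by distance. -/
lemma abs_geodesics_step_le (d i j : ℕ) {l : ℕ} (hl : 1 ≤ l) :
    |prob d (fun (G : SimpleGraph V) u v => numGeodesics G u v = l ∧ Far i j G u v) -
      prob d (fun (G : SimpleGraph V) u v => numGeodesics G u v = l ∧ Far (i + 1) j G u v) -
      prob d (Linked (V := V) i j l)| ≤
    prob d (fun (G : SimpleGraph V) u v => Far i j G u v ∧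
        walkCount G u (i + 1 + j) v ≠ (midDarts G u v i j).card) := by
  have key : ∀ (G : SimpleGraph V) u v, (Far (i + 1) j G u v → Far i j G u v) ∧
      (Linked i j l G u v → Far i j G u v ∧ ¬ Far (i + 1) j G u v) ∧
      (Far i j G u v → ¬ Far (i + 1) j G u v →
        walkCount G u (i + 1 + j) v = (midDarts G u v i j).card →
        (numGeodesics G u v = l ↔ Linked i j l G u v)) := by
    intro G u v
    refine ⟨fun h => (card_midDarts_eq_zero_iff.2 h).1, fun h => ⟨h.1, fun h' => ?_⟩, ?_⟩
    · have := (card_midDarts_eq_zero_iff.2 h').2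
      have := h.2
      omega
    · intro hF hF' hN
      have hm : (midDarts G u v i j).card ≠ 0 := fun h =>
        hF' (card_midDarts_eq_zero_iff.1 ⟨hF, h⟩)
      rw [numGeodesics_eq_walkCount hF hm, hN]
      exact ⟨fun h => ⟨hF, h⟩, fun h => h.2⟩
  rw [abs_le]
  constructor
  · have : prob d (fun (G : SimpleGraph V) u v => numGeodesics G u v = l ∧ Far (i + 1) j G u v) +
      prob d (Linked (V := V) i j l) ≤
      prob d (fun (G : SimpleGraph V) u v => numGeodesics G u v = l ∧ Far i j G u v) +
      prob d (fun (G : SimpleGraph V) u v => Far i j G u v ∧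
        walkCount G u (i + 1 + j) v ≠ (midDarts G u v i j).card) := by
      rw [prob, prob, prob, prob, ← expect_add, ← expect_add]
      refine expect_mono fun G u v _ => ?_
      obtain ⟨k1, k2, k3⟩ := key G u v
      convert (indicator_step k1 k2 k3).1
    linarith
  · have : prob d (fun (G : SimpleGraph V) u v => numGeodesics G u v = l ∧ Far i j G u v) ≤
      prob d (fun (G : SimpleGraph V) u v => numGeodesics G u v = l ∧ Far (i + 1) j G u v) +
      prob d (Linked (V := V) i j l) +
      prob d (fun (G : SimpleGraph V) u v => Far i j G u v ∧
        walkCount G u (i + 1 + j) v ≠ (midDarts G u v i j).card) := by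
      rw [prob, prob, prob, prob, ← expect_add, ← expect_add]
      refine expect_mono fun G u v _ => ?_
      obtain ⟨k1, k2, k3⟩ := key G u v
      convert (indicator_step k1 k2 k3).2
    linarith

end
end RandomRegular

/-! ### Analysis: from ratios to the limiting series -/

namespace RandomRegular
section
open Topology

variable {α : Type*} {F : Filter α}

lemma tendsto_zero_of_bounded_mul {f g : α → ℝ} {C : ℝ} (hf : ∀ᶠ n in F, |f n| ≤ C)
    (hg : Tendsto g F (𝓝 0)) : Tendsto (fun n => f n * g n) F (𝓝 0) := by
  have h := (hg.abs.const_mul C)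
  rw [abs_zero, mul_zero] at h
  refine squeeze_zero_norm' ?_ h
  filter_upwards [hf] with n hn
  rw [Real.norm_eq_abs, abs_mul]
  exact mul_le_mul_of_nonneg_right hn (abs_nonneg _)

lemma tendsto_zero_of_forall_abs_le {f : α → ℝ} (h : ∀ ε > 0, ∀ᶠ n in F, |f n| ≤ ε) :
    Tendsto f F (𝓝 0) := by
  rw [Metric.tendsto_nhds]
  intro ε hε
  filter_upwards [h (ε / 2) (by positivity)] with n hn
  rw [Real.dist_eq, sub_zero]
  linarith

lemma hasSum_exp (x : ℝ) : HasSum (fun l : ℕ => x ^ l / l.factorial) (Real.exp x) := by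
  rw [Real.exp_eq_exp_ℝ]
  exact NormedSpace.expSeries_div_hasSum_exp x

/-- The tail of the exponential series has nonnegative coefficients, so it increases with x;
truncation is uniform in bounded x. -/
lemma exp_sub_sum_le {x X : ℝ} (hx : 0 ≤ x) (hX : x ≤ X) (K : ℕ) :
    |Real.exp x - ∑ l ∈ Finset.range K, x ^ l / l.factorial| ≤
      Real.exp X - ∑ l ∈ Finset.range K, X ^ l / l.factorial := by
  rw [abs_of_nonneg]
  · have := sum_le_hasSum (Finset.range K) (fun l _ => ?_) ((hasSum_exp X).sub (hasSum_exp x))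
    · rw [Finset.sum_sub_distrib] at this
      linarith
    · have : x ^ l ≤ X ^ l := pow_le_pow_left₀ hx hX l
      rw [← sub_div]
      exact div_nonneg (by linarith) (by positivity)
  · have := sum_le_hasSum (Finset.range K) (fun l _ => by positivity) (hasSum_exp x)
    linarith

/-- Probabilities with asymptotically Poisson ratios are asymptotically proportional to Poisson
weights. -/
lemma tendsto_sub_poisson_weight {a : ℕ → α → ℝ} {x : α → ℝ} {X : ℝ}
    (hx : ∀ n, 0 ≤ x n) (hX : ∀ n, x n ≤ X)
    (h1 : ∀ l : ℕ, Tendsto (fun n => ((l : ℝ) + 1) * a (l + 1) n - x n * a l n) F (𝓝 0)) (l : ℕ) :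
    Tendsto (fun n => a l n - x n ^ l / l.factorial * a 0 n) F (𝓝 0) := by
  induction l with
  | zero => simp [tendsto_const_nhds]
  | succ l ih =>
    have h2 : Tendsto (fun n => x n * (a l n - x n ^ l / l.factorial * a 0 n)) F (𝓝 0) :=
      tendsto_zero_of_bounded_mul (C := X)
        (Eventually.of_forall fun n => by rw [abs_of_nonneg (hx n)]; exact hX n) ih
    have h3 := ((h1 l).add h2).const_mul (1 / ((l : ℝ) + 1))
    rw [add_zero, mul_zero] at h3
    refine h3.congr fun n => ?_
    rw [Nat.factorial_succ]
    push_cast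
    field_simp
    ring

/-- The ratios give a_l ≈ a_0 x^l/l! for each fixed l. Summing over l < K gives p ≈ a_0 e^x, with
the rest controlled by C/K and the exponential tail, so a_0 ≈ p e^(-x). -/
lemma tendsto_zero_class {a : ℕ → α → ℝ} {x p : α → ℝ} {X C : ℝ}
    (hx : ∀ n, 0 ≤ x n) (hX : ∀ n, x n ≤ X)
    (h1 : ∀ l : ℕ, Tendsto (fun n => ((l : ℝ) + 1) * a (l + 1) n - x n * a l n) F (𝓝 0))
    (h0 : ∀ᶠ n in F, |a 0 n| ≤ 1)
    (h3 : ∀ K : ℕ, 0 < K → ∀ᶠ n in F, |p n - ∑ l ∈ Finset.range K, a l n| ≤ C / K) :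
    Tendsto (fun n => a 0 n - p n * Real.exp (-x n)) F (𝓝 0) := by
  have key : Tendsto (fun n => p n - a 0 n * Real.exp (x n)) F (𝓝 0) := by
    refine tendsto_zero_of_forall_abs_le fun ε hε => ?_
    have e1 : ∀ᶠ K : ℕ in atTop, C / K < ε / 3 :=
      (tendsto_const_div_atTop_nhds_zero_nat C).eventually_lt_const (by positivity)
    have e2 : ∀ᶠ K : ℕ in atTop, Real.exp X - ∑ l ∈ Finset.range K, X ^ l / l.factorial < ε / 3 := by
      have := (hasSum_exp X).tendsto_sum_nat.const_sub (Real.exp X)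
      rw [sub_self] at this
      exact this.eventually_lt_const (by positivity)
    obtain ⟨K, hK1, hK2, hK⟩ := (e1.and (e2.and (eventually_gt_atTop 0))).exists
    have h4 : Tendsto (fun n => ∑ l ∈ Finset.range K, |a l n - x n ^ l / l.factorial * a 0 n|) F
        (𝓝 0) := by
      have := tendsto_finsetSum (Finset.range K) fun l _ =>
        (tendsto_sub_poisson_weight hx hX h1 l).abs
      simpa using this
    filter_upwards [h0, h3 K hK, h4.eventually_lt_const (show (0 : ℝ) < ε / 3 by positivity)]
      with n n0 n3 n4
    have e : p n - a 0 n * Real.exp (x n) = (p n - ∑ l ∈ Finset.range K, a l n) +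
        ∑ l ∈ Finset.range K, (a l n - x n ^ l / l.factorial * a 0 n) -
        a 0 n * (Real.exp (x n) - ∑ l ∈ Finset.range K, x n ^ l / l.factorial) := by
      rw [Finset.sum_sub_distrib, ← Finset.sum_mul]
      ring
    have b1 := Finset.abs_sum_le_sum_abs (fun l => a l n - x n ^ l / l.factorial * a 0 n)
      (Finset.range K)
    have b2 : |a 0 n * (Real.exp (x n) - ∑ l ∈ Finset.range K, x n ^ l / l.factorial)| ≤ ε / 3 := by
      rw [abs_mul]
      calc _ ≤ 1 * (ε / 3) := mul_le_mul n0 ((exp_sub_sum_le (hx n) (hX n) K).trans hK2.le)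
            (abs_nonneg _) zero_le_one
        _ = _ := one_mul _
    rw [e]
    calc _ ≤ |p n - ∑ l ∈ Finset.range K, a l n| +
          |∑ l ∈ Finset.range K, (a l n - x n ^ l / l.factorial * a 0 n)| +
          |a 0 n * (Real.exp (x n) - ∑ l ∈ Finset.range K, x n ^ l / l.factorial)| :=
          (abs_sub _ _).trans (add_le_add_left (abs_add_le _ _) _)
      _ ≤ ε := by linarith
  have h := tendsto_zero_of_bounded_mul (C := 1) (f := fun n => -Real.exp (-x n))
    (Eventually.of_forall fun n => ?_) key
  · refine h.congr fun n => ?_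
    have : Real.exp (-x n) * Real.exp (x n) = 1 := by rw [← Real.exp_add]; simp
    linear_combination a 0 n * this
  · rw [abs_neg, abs_of_pos (Real.exp_pos _), Real.exp_le_one_iff]
    linarith [hx n]

/-- The survival probabilities, from their recursion and their values far to the left. -/
lemma tendsto_survival {q θ₁ : ℝ} (hq : 2 ≤ q) {θ : α → ℝ} (hθ0 : ∀ n, 0 ≤ θ n)
    (hθ1 : ∀ n, θ n ≤ θ₁) {p : ℤ → α → ℝ}
    (hrec : ∀ h, Tendsto (fun n => p (h + 1) n - p h n * Real.exp (-(θ n * q ^ h))) F (𝓝 0))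
    (hlow : ∀ h, ∀ᶠ n in F, 1 - θ n * q ^ h ≤ p h n ∧ p h n ≤ 1) (h : ℤ) :
    Tendsto (fun n => p h n - Real.exp (-(θ n * q ^ h / (q - 1)))) F (𝓝 0) := by
  have hq0 : 0 < q := by linarith
  have hq1 : 0 < q - 1 := by linarith
  -- The limit solves the recursion exactly, as q^(h+1)/(q - 1) = q^h/(q - 1) + q^h. Errors are
  -- multiplied by an exponential at most 1, so they do not grow.
  have step : ∀ (ε : ℝ) (h : ℤ),
      (∀ δ > ε, ∀ᶠ n in F, |p h n - Real.exp (-(θ n * q ^ h / (q - 1)))| ≤ δ) →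
      ∀ δ > ε, ∀ᶠ n in F, |p (h + 1) n - Real.exp (-(θ n * q ^ (h + 1) / (q - 1)))| ≤ δ := by
    intro ε h hP δ hδ
    have h1 := (hrec h).abs
    rw [abs_zero] at h1
    filter_upwards [hP ((ε + δ) / 2) (by linarith),
      h1.eventually_lt_const (show 0 < (δ - ε) / 2 by linarith)] with n n1 n2
    have e : Real.exp (-(θ n * q ^ (h + 1) / (q - 1))) =
        Real.exp (-(θ n * q ^ h / (q - 1))) * Real.exp (-(θ n * q ^ h)) := by
      rw [← Real.exp_add, zpow_add_one₀ hq0.ne']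
      congr 1
      field_simp
      ring
    have e' : p (h + 1) n - Real.exp (-(θ n * q ^ (h + 1) / (q - 1))) =
        (p (h + 1) n - p h n * Real.exp (-(θ n * q ^ h))) +
        (p h n - Real.exp (-(θ n * q ^ h / (q - 1)))) * Real.exp (-(θ n * q ^ h)) := by
      rw [e]; ring
    have b : |(p h n - Real.exp (-(θ n * q ^ h / (q - 1)))) * Real.exp (-(θ n * q ^ h))| ≤
        (ε + δ) / 2 := by
      rw [abs_mul, abs_of_pos (Real.exp_pos _)]
      refine (mul_le_of_le_one_right (abs_nonneg _) ?_).trans n1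
      rw [Real.exp_le_one_iff]
      have := hθ0 n
      have : 0 ≤ θ n * q ^ h := by positivity
      linarith
    rw [e']
    refine (abs_add_le _ _).trans ?_
    linarith
  -- Both quantities lie within θ q^h of 1 and below it, which is a good approximation far to the
  -- left. Propagating from h - k with k large then gives the claim.
  have start : ∀ h : ℤ, ∀ δ > θ₁ * q ^ h, ∀ᶠ n in F,
      |p h n - Real.exp (-(θ n * q ^ h / (q - 1)))| ≤ δ := by
    intro h δ hδ
    filter_upwards [hlow h] with n hn
    have y0 : 0 ≤ θ n * q ^ h := mul_nonneg (hθ0 n) (by positivity)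
    have y1 : θ n * q ^ h ≤ θ₁ * q ^ h := mul_le_mul_of_nonneg_right (hθ1 n) (by positivity)
    have y2 : θ n * q ^ h / (q - 1) ≤ θ n * q ^ h := div_le_self y0 (by linarith)
    have y3 : 0 ≤ θ n * q ^ h / (q - 1) := by positivity
    have z1 := Real.add_one_le_exp (-(θ n * q ^ h / (q - 1)))
    have z2 : Real.exp (-(θ n * q ^ h / (q - 1))) ≤ 1 := by
      rw [Real.exp_le_one_iff]; linarith
    rw [abs_le]
    constructor <;> linarith [hn.1, hn.2]
  have all : ∀ (k : ℕ) (h : ℤ), ∀ δ > θ₁ * q ^ h, ∀ᶠ n in F,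
      |p (h + k) n - Real.exp (-(θ n * q ^ (h + k) / (q - 1)))| ≤ δ := by
    intro k h
    induction k with
    | zero => simpa using start h
    | succ k ih =>
      have := step _ _ ih
      push_cast
      rwa [← add_assoc]
  refine tendsto_zero_of_forall_abs_le fun ε hε => ?_
  have hlim : Tendsto (fun k : ℕ => θ₁ * q ^ (h - k)) atTop (𝓝 0) := by
    have h1 : Tendsto (fun k : ℕ => (q⁻¹) ^ k) atTop (𝓝 0) :=
      tendsto_pow_atTop_nhds_zero_of_lt_one (by positivity) (inv_lt_one_of_one_lt₀ (by linarith))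
    have h2 := h1.const_mul (θ₁ * q ^ h)
    rw [mul_zero] at h2
    refine h2.congr fun k => ?_
    rw [zpow_sub₀ hq0.ne', zpow_natCast, inv_pow]
    ring
  obtain ⟨k, hk⟩ := (hlim.eventually_lt_const hε).exists
  have := all k (h - k) ε hk
  rwa [sub_add_cancel] at this

/-- The limiting probability of `l` geodesics of a given length when the mean number of paths of
that length is `y`. -/
noncomputable def weight (q : ℝ) (l : ℕ) (y : ℝ) : ℝ :=
  y ^ l / l.factorial * Real.exp (-(q * y / (q - 1)))

lemma weight_nonneg (q : ℝ) (l : ℕ) {y : ℝ} (hy : 0 ≤ y) : 0 ≤ weight q l y := by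
  unfold weight
  positivity

lemma weight_le_poisson {q : ℝ} (hq : 2 ≤ q) (l : ℕ) {y : ℝ} (hy : 0 ≤ y) :
    weight q l y ≤ y ^ l / l.factorial * Real.exp (-y) := by
  unfold weight
  have : y ≤ q * y / (q - 1) := by
    rw [le_div_iff₀ (by linarith)]
    nlinarith
  gcongr

/-- Useful for small y, that is, for short lengths; `weight_le_inv` serves large y. Together they
give geometric decay in both directions. -/
lemma weight_le_self {q : ℝ} (hq : 2 ≤ q) {l : ℕ} (hl : 1 ≤ l) {y : ℝ} (hy : 0 ≤ y) :
    weight q l y ≤ y := by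
  refine (weight_le_poisson hq l hy).trans ?_
  obtain ⟨m, rfl⟩ : ∃ m, l = m + 1 := ⟨l - 1, by omega⟩
  have h := Real.pow_div_factorial_le_exp y hy m
  have h1 : y ^ (m + 1) / (m + 1).factorial ≤ y * (y ^ m / m.factorial) := by
    rw [Nat.factorial_succ, pow_succ, mul_comm (y ^ m) y, mul_div_assoc]
    gcongr
    exact le_mul_of_one_le_left (by positivity) (by simp)
  calc _ ≤ y * Real.exp y * Real.exp (-y) := by gcongr; exact h1.trans (by gcongr)
    _ = y := by rw [mul_assoc, ← Real.exp_add]; simp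

lemma weight_le_inv {q : ℝ} (hq : 2 ≤ q) (l : ℕ) {y : ℝ} (hy : 0 < y) :
    weight q l y ≤ (l + 1) / y := by
  refine (weight_le_poisson hq l hy.le).trans ?_
  have h := Real.pow_div_factorial_le_exp y hy.le (l + 1)
  have h1 : y ^ l / l.factorial = (l + 1) / y * (y ^ (l + 1) / (l + 1).factorial) := by
    rw [Nat.factorial_succ]
    push_cast
    rw [pow_succ]
    field_simp
  calc _ ≤ (l + 1) / y * Real.exp y * Real.exp (-y) := by rw [h1]; gcongr
    _ = _ := by rw [mul_assoc, ← Real.exp_add]; simp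

/-- Two consecutive lengths. -/
noncomputable def pairWeight (q : ℝ) (l : ℕ) (t : ℝ) (k : ℤ) : ℝ :=
  weight q l (t * q ^ (2 * k - 1)) + weight q l (t * q ^ (2 * k))

lemma weight_zpow_le {q θ₀ θ₁ t : ℝ} (hq : 2 ≤ q) {l : ℕ} (hl : 1 ≤ l) (h0 : 0 < θ₀)
    (ht0 : θ₀ ≤ t) (ht1 : t ≤ θ₁) (h : ℤ) :
    weight q l (t * q ^ h) ≤ (θ₁ + (l + 1) / θ₀) * (q⁻¹) ^ h.natAbs := by
  have hq0 : 0 < q := by linarith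
  have ht : 0 < t := h0.trans_le ht0
  have hθ : 0 < θ₁ := ht.trans_le ht1
  have hy : 0 < t * q ^ h := by positivity
  rcases le_total h 0 with hh | hh
  · refine (weight_le_self hq hl hy.le).trans ?_
    have : q ^ h = (q⁻¹) ^ h.natAbs := by
      rw [← zpow_natCast, Int.ofNat_natAbs_of_nonpos hh, inv_zpow', neg_neg]
    rw [this]
    gcongr
    have : 0 ≤ ((l : ℝ) + 1) / θ₀ := by positivity
    linarith
  · refine (weight_le_inv hq l hy).trans ?_
    have : q ^ h = q ^ h.natAbs := by
      rw [← zpow_natCast, Int.natAbs_of_nonneg hh]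
    rw [this, inv_pow, ← div_eq_mul_inv, ← div_div]
    gcongr
    have : ((l : ℝ) + 1) / t ≤ (l + 1) / θ₀ := by gcongr
    linarith

lemma pairWeight_nonneg {q t : ℝ} (hq : 2 ≤ q) (ht : 0 ≤ t) (l : ℕ) (k : ℤ) :
    0 ≤ pairWeight q l t k :=
  add_nonneg (weight_nonneg q l (by positivity)) (weight_nonneg q l (by positivity))

lemma pairWeight_le {q θ₀ θ₁ t : ℝ} (hq : 2 ≤ q) {l : ℕ} (hl : 1 ≤ l) (h0 : 0 < θ₀)
    (ht0 : θ₀ ≤ t) (ht1 : t ≤ θ₁) (k : ℤ) :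
    pairWeight q l t k ≤ 2 * (θ₁ + (l + 1) / θ₀) * q * (q⁻¹) ^ k.natAbs := by
  have hq0 : 0 < q := by linarith
  have hθ : 0 < θ₁ := h0.trans_le (ht0.trans ht1)
  have hC : 0 ≤ θ₁ + (l + 1) / θ₀ := by positivity
  have key : ∀ h : ℤ, k.natAbs ≤ h.natAbs + 1 →
      weight q l (t * q ^ h) ≤ (θ₁ + (l + 1) / θ₀) * (q * (q⁻¹) ^ k.natAbs) := by
    intro h hk
    refine (weight_zpow_le hq hl h0 ht0 ht1 h).trans ?_
    refine mul_le_mul_of_nonneg_left ?_ hC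
    have h1 : (q⁻¹) ^ (h.natAbs + 1) ≤ (q⁻¹) ^ k.natAbs :=
      pow_le_pow_of_le_one (by positivity) (inv_le_one_of_one_le₀ (by linarith)) hk
    calc (q⁻¹) ^ h.natAbs = q * (q⁻¹) ^ (h.natAbs + 1) := by rw [pow_succ]; field_simp
      _ ≤ _ := by gcongr
  have k1 := key (2 * k - 1) (by omega)
  have k2 := key (2 * k) (by omega)
  unfold pairWeight
  linarith

lemma summable_inv_pow_natAbs {q : ℝ} (hq : 2 ≤ q) :
    Summable fun k : ℤ => (q⁻¹) ^ k.natAbs := by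
  have h : Summable fun k : ℕ => (q⁻¹) ^ k := summable_geometric_of_lt_one
    (inv_nonneg.2 (by linarith)) (inv_lt_one_of_one_lt₀ (by linarith))
  refine Summable.of_nat_of_neg ?_ ?_ <;> simpa using h

lemma summable_pairWeight {q t : ℝ} (hq : 2 ≤ q) {l : ℕ} (hl : 1 ≤ l) (ht : 0 < t) :
    Summable (pairWeight q l t) :=
  Summable.of_nonneg_of_le (pairWeight_nonneg hq ht.le l)
    (pairWeight_le hq hl ht le_rfl le_rfl) ((summable_inv_pow_natAbs hq).mul_left _)

/-- The differences of g telescope; offsets are taken two at a time, 2k - 1 and 2k, to match the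
terms of the series. -/
lemma tendsto_window {q : ℝ} {l : ℕ} {θ : α → ℝ} {g : ℤ → α → ℝ}
    (hg : ∀ h, Tendsto (fun n => g h n - g (h + 1) n - weight q l (θ n * q ^ h)) F (𝓝 0))
    {a b : ℤ} (hab : a ≤ b) : Tendsto (fun n => g (2 * a - 1) n - g (2 * b - 1) n -
      ∑ k ∈ Finset.Ico a b, pairWeight q l (θ n) k) F (𝓝 0) := by
  induction b, hab using Int.leInduction with
  | base => simp [tendsto_const_nhds]
  | succ b hab ih =>
    have h1 := (ih.add (hg (2 * b - 1))).add (hg (2 * b - 1 + 1))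
    rw [add_zero, add_zero] at h1
    refine h1.congr fun n => ?_
    have e : Finset.Ico a (b + 1) = insert b (Finset.Ico a b) := by
      ext k
      simp only [Finset.mem_insert, Finset.mem_Ico]
      omega
    rw [e, Finset.sum_insert (by simp), pairWeight]
    have e1 : 2 * b - 1 + 1 = 2 * b := by ring
    have e2 : 2 * (b + 1) - 1 = 2 * b + 1 := by ring
    rw [e1, e2]
    ring

/-- Truncate to a window of offsets: left of it u and v are almost surely still far, right of it
almost surely no longer far, and the omitted terms have a summable bound independent of n. -/
lemma tendsto_sub_tsum {q θ₀ θ₁ : ℝ} (hq : 2 ≤ q) {θ : α → ℝ} (h0 : 0 < θ₀)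
    (hθ0 : ∀ n, θ₀ ≤ θ n) (hθ1 : ∀ n, θ n ≤ θ₁) {l : ℕ} (hl : 1 ≤ l) {p g : ℤ → α → ℝ}
    {P : α → ℝ}
    (hsurv : ∀ h, Tendsto (fun n => p h n - Real.exp (-(θ n * q ^ h / (q - 1)))) F (𝓝 0))
    (hlow : ∀ h, ∀ᶠ n in F, 1 - θ n * q ^ h ≤ p h n ∧ p h n ≤ 1)
    (hg : ∀ h, Tendsto (fun n => g h n - g (h + 1) n - weight q l (θ n * q ^ h)) F (𝓝 0))
    (hgp : ∀ h, ∀ᶠ n in F, 0 ≤ g h n ∧ g h n ≤ p h n ∧ |P n - g h n| ≤ 1 - p h n) :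
    Tendsto (fun n => P n - ∑' k, pairWeight q l (θ n) k) F (𝓝 0) := by
  have hq0 : 0 < q := by linarith
  set B : ℤ → ℝ := fun k => 2 * (θ₁ + (l + 1) / θ₀) * q * (q⁻¹) ^ k.natAbs with hB
  have hBs : Summable B := (summable_inv_pow_natAbs hq).mul_left _
  have hTB : ∀ n k, pairWeight q l (θ n) k ≤ B k := fun n k =>
    pairWeight_le hq hl h0 (hθ0 n) (hθ1 n) k
  have hTs : ∀ n, Summable (pairWeight q l (θ n)) := fun n =>
    summable_pairWeight hq hl (h0.trans_le (hθ0 n))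
  refine tendsto_zero_of_forall_abs_le fun ε hε => ?_
  have c0 : Tendsto (fun K : ℕ => q ^ (2 * (K : ℤ) - 1)) atTop atTop := by
    have h1 : Tendsto (fun K : ℕ => (q ^ 2) ^ K) atTop atTop :=
      tendsto_pow_atTop_atTop_of_one_lt (by nlinarith)
    refine (h1.atTop_mul_const (inv_pos.2 hq0)).congr fun K => ?_
    rw [zpow_sub_one₀ hq0.ne', ← pow_mul, ← zpow_natCast]
    push_cast
    rfl
  have c1 : ∀ᶠ K : ℕ in atTop, θ₁ * q ^ (2 * (-(K : ℤ)) - 1) < ε / 5 := by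
    have h1 := (tendsto_inv_atTop_zero.comp c0).const_mul (θ₁ * q ^ (-2 : ℤ))
    rw [mul_zero] at h1
    refine (h1.congr fun K => ?_).eventually_lt_const (by positivity)
    rw [Function.comp_apply, ← zpow_neg, mul_assoc, ← zpow_add₀ hq0.ne']
    congr 2
    ring
  have c2 : ∀ᶠ K : ℕ in atTop, Real.exp (-(θ₀ * q ^ (2 * (K : ℤ) - 1) / (q - 1))) < ε / 5 := by
    have h1 : Tendsto (fun K : ℕ => θ₀ * q ^ (2 * (K : ℤ) - 1) / (q - 1)) atTop atTop :=
      (c0.const_mul_atTop h0).atTop_div_const (by linarith)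
    exact (Real.tendsto_exp_neg_atTop_nhds_zero.comp h1).eventually_lt_const (by positivity)
  have hBt : Tendsto (fun s : Finset ℤ => ∑ k ∈ s, B k) atTop (𝓝 (∑' k, B k)) := hBs.hasSum
  obtain ⟨s, hs⟩ := (hBt.eventually_const_lt
    (show ∑' k, B k - ε / 5 < ∑' k, B k by linarith)).exists_forall_of_atTop
  have c3 : ∀ᶠ K : ℕ in atTop, s ⊆ Finset.Ico (-(K : ℤ)) K := by
    have : ∀ k ∈ s, ∀ᶠ K : ℕ in atTop, k ∈ Finset.Ico (-(K : ℤ)) K := by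
      intro k _
      filter_upwards [eventually_gt_atTop k.natAbs] with K hK
      rw [Finset.mem_Ico]
      omega
    exact (s.eventually_all.2 this)
  obtain ⟨K, hK1, hK2, hK3⟩ := (c1.and (c2.and c3)).exists
  have hw := (tendsto_window hg (show -(K : ℤ) ≤ K by omega)).abs
  have hsv := hsurv (2 * (K : ℤ) - 1)
  rw [abs_zero] at hw
  filter_upwards [hw.eventually_lt_const (show 0 < ε / 5 by positivity),
    hsv.eventually_lt_const (show 0 < ε / 5 by positivity),
    hlow (2 * (-(K : ℤ)) - 1), hgp (2 * (-(K : ℤ)) - 1), hgp (2 * (K : ℤ) - 1)]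
    with n n1 n2 n3 n4 n5
  set W := Finset.Ico (-(K : ℤ)) K
  have t1 : 0 ≤ ∑' k, pairWeight q l (θ n) k - ∑ k ∈ W, pairWeight q l (θ n) k :=
    sub_nonneg.2 ((hTs n).sum_le_tsum W fun k _ =>
      pairWeight_nonneg hq (h0.le.trans (hθ0 n)) l k)
  have t2 : ∑' k, pairWeight q l (θ n) k - ∑ k ∈ W, pairWeight q l (θ n) k ≤ ε / 5 := by
    have h1 := (hBs.sub (hTs n)).sum_le_tsum W fun k _ => sub_nonneg.2 (hTB n k)
    rw [hBs.tsum_sub (hTs n), Finset.sum_sub_distrib] at h1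
    have := hs W hK3
    linarith
  have t3 : |P n - g (2 * (-(K : ℤ)) - 1) n| ≤ ε / 5 := by
    refine n4.2.2.trans ?_
    have : θ n * q ^ (2 * (-(K : ℤ)) - 1) ≤ θ₁ * q ^ (2 * (-(K : ℤ)) - 1) :=
      mul_le_mul_of_nonneg_right (hθ1 n) (by positivity)
    linarith [n3.1]
  have t4 : g (2 * (K : ℤ) - 1) n ≤ 2 * (ε / 5) := by
    have : Real.exp (-(θ n * q ^ (2 * (K : ℤ) - 1) / (q - 1))) ≤
        Real.exp (-(θ₀ * q ^ (2 * (K : ℤ) - 1) / (q - 1))) := by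
      have := hθ0 n
      have : 0 < q - 1 := by linarith
      gcongr
    linarith [n5.2.1]
  have t5 := n5.1
  rw [abs_le] at t3 ⊢
  rw [abs_lt] at n1
  constructor <;> linarith [t3.1, t3.2, n1.1, n1.2]

/-- The limit law, from the ratios, the survival probabilities and the decomposition by distance. -/
lemma tendsto_sub_tsum_of_ratio {q θ₀ θ₁ : ℝ} (hq : 2 ≤ q) {θ : α → ℝ} (h0 : 0 < θ₀)
    (hθ0 : ∀ n, θ₀ ≤ θ n) (hθ1 : ∀ n, θ n ≤ θ₁) {l : ℕ} (hl : 1 ≤ l)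
    {a : ℤ → ℕ → α → ℝ} {p g : ℤ → α → ℝ} {P : α → ℝ}
    (h1 : ∀ (h : ℤ) (l : ℕ),
      Tendsto (fun n => ((l : ℝ) + 1) * a h (l + 1) n - θ n * q ^ h * a h l n) F (𝓝 0))
    (h2 : ∀ h, ∀ᶠ n in F, a h 0 n = p (h + 1) n)
    (h3 : ∀ h, ∃ C : ℝ, ∀ K : ℕ, 0 < K → ∀ᶠ n in F,
      |p h n - ∑ l ∈ Finset.range K, a h l n| ≤ C / K)
    (hlow : ∀ h, ∀ᶠ n in F, 1 - θ n * q ^ h ≤ p h n ∧ p h n ≤ 1)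
    (hg : ∀ h, Tendsto (fun n => g h n - g (h + 1) n - a h l n) F (𝓝 0))
    (hgp : ∀ h, ∀ᶠ n in F, 0 ≤ g h n ∧ g h n ≤ p h n ∧ |P n - g h n| ≤ 1 - p h n) :
    Tendsto (fun n => P n - ∑' k, pairWeight q l (θ n) k) F (𝓝 0) := by
  have hq0 : 0 < q := by linarith
  have hq1 : 0 < q - 1 := by linarith
  have hx : ∀ (h : ℤ) n, 0 ≤ θ n * q ^ h := fun h n =>
    mul_nonneg (h0.le.trans (hθ0 n)) (by positivity)
  have hX : ∀ (h : ℤ) n, θ n * q ^ h ≤ θ₁ * q ^ h := fun h n =>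
    mul_le_mul_of_nonneg_right (hθ1 n) (by positivity)
  have hz : ∀ h, Tendsto (fun n => a h 0 n - p h n * Real.exp (-(θ n * q ^ h))) F (𝓝 0) := by
    intro h
    obtain ⟨C, hC⟩ := h3 h
    refine tendsto_zero_class (hx h) (hX h) (h1 h) ?_ hC
    filter_upwards [h2 h, hlow (h + 1), hgp (h + 1)] with n n1 n2 n3
    rw [n1, abs_le]
    constructor <;> linarith [n2.2, n3.1, n3.2.1]
  -- The zero class at offset h is survival to offset h + 1, so its Poisson weight becomes the
  -- survival recursion.
  have hrec : ∀ h, Tendsto (fun n => p (h + 1) n - p h n * Real.exp (-(θ n * q ^ h))) F (𝓝 0) :=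
    fun h => (hz h).congr' (by filter_upwards [h2 h] with n hn; rw [hn])
  have hsurv := tendsto_survival hq (fun n => h0.le.trans (hθ0 n)) hθ1 hrec hlow
  refine tendsto_sub_tsum hq h0 hθ0 hθ1 hl hsurv hlow (fun h => ?_) hgp
  have e1 := tendsto_sub_poisson_weight (hx h) (hX h) (h1 h) l
  have e2 := hsurv (h + 1)
  have e3 : Tendsto (fun n => a h 0 n - Real.exp (-(θ n * q ^ (h + 1) / (q - 1)))) F (𝓝 0) :=
    e2.congr' (by filter_upwards [h2 h] with n hn; rw [hn])
  have e4 := tendsto_zero_of_bounded_mul (C := (θ₁ * q ^ h) ^ l / l.factorial)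
    (f := fun n => (θ n * q ^ h) ^ l / l.factorial) (Eventually.of_forall fun n => by
      rw [abs_of_nonneg (div_nonneg (pow_nonneg (hx h n) l) (by positivity))]
      gcongr
      · exact hx h n
      · exact hθ1 n) e3
  have e5 := ((hg h).add e1).add e4
  rw [add_zero, add_zero] at e5
  refine e5.congr fun n => ?_
  have : q * (θ n * q ^ h) / (q - 1) = θ n * q ^ (h + 1) / (q - 1) := by
    rw [zpow_add_one₀ hq0.ne']
    ring
  rw [weight, this]
  ring

end
end RandomRegular

/-! ### Radii at half the logarithm of n, and the limit -/

namespace RandomRegular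
section
open Topology

/-- At radii with q^i = O(√n), the mean deficit is bounded. -/
lemma deficitBound_le {q n i : ℕ} {C : ℝ} (hn : 0 < n) (hi : (q : ℝ) ^ i ≤ C * √n) :
    deficitBound q n i ≤ 4 * ((q : ℝ) + 1) ^ 4 * C ^ 2 := by
  have hn' : (0 : ℝ) < n := by exact_mod_cast hn
  rw [deficitBound, div_le_iff₀ hn', mul_comm 2 i, pow_mul]
  calc _ ≤ 4 * ((q : ℝ) + 1) ^ 4 * (C * √n) ^ 2 := by gcongr
    _ = _ := by rw [mul_pow, Real.sq_sqrt hn'.le]; ring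

lemma tendsto_const_div_sqrt (A : ℝ) : Tendsto (fun n : ℕ => A / √(n : ℝ)) atTop (𝓝 0) :=
  tendsto_const_nhds.div_atTop (Real.tendsto_sqrt_atTop.comp tendsto_natCast_atTop_atTop)

lemma eventually_mul_sqrt_le (A B : ℝ) : ∀ᶠ n : ℕ in atTop, A * √(n : ℝ) + B ≤ n := by
  have h1 := (tendsto_const_div_sqrt A).add (tendsto_const_div_atTop_nhds_zero_nat B)
  rw [add_zero] at h1
  filter_upwards [h1.eventually_lt_const zero_lt_one, eventually_gt_atTop 0] with n n1 n2
  have hn : (0 : ℝ) < n := by exact_mod_cast n2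
  have hs : 0 < √(n : ℝ) := Real.sqrt_pos.2 hn
  have h2 := mul_lt_mul_of_pos_right n1 hn
  have e1 : A / √(n : ℝ) * n = A * √n := by
    rw [div_mul_eq_mul_div, div_eq_iff hs.ne', mul_assoc, Real.mul_self_sqrt hn.le]
  have e2 : B / n * n = B := div_mul_cancel₀ _ hn.ne'
  rw [add_mul, e1, e2, one_mul] at h2
  exact h2.le

lemma eventually_ball_small {q : ℕ} {I : ℕ → ℕ} {C : ℝ}
    (hI : ∀ᶠ n in atTop, (q : ℝ) ^ I n ≤ C * √(n : ℝ)) :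
    ∀ᶠ n in atTop, 4 * ((q + 1) * q ^ I n + (q + 1)) ≤ n := by
  filter_upwards [hI, eventually_mul_sqrt_le (4 * (q + 1) * C) (4 * (q + 1))] with n n1 n2
  have : 4 * (((q : ℝ) + 1) * q ^ I n + (q + 1)) ≤ n := by
    refine le_trans ?_ n2
    have : ((q : ℝ) + 1) * q ^ I n ≤ (q + 1) * (C * √n) := by gcongr
    linarith
  exact_mod_cast this

lemma tendsto_ratio_error {q l : ℕ} {I J : ℕ → ℕ} {C : ℝ} (hC : 0 ≤ C)
    (hI : ∀ᶠ n in atTop, (q : ℝ) ^ I n ≤ C * √(n : ℝ))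
    (hJ : ∀ᶠ n in atTop, (q : ℝ) ^ J n ≤ C * √(n : ℝ)) :
    Tendsto (fun n : ℕ => (linkError q n (I n) (J n) l + ((l : ℝ) + 1) *
      (2 * ((q : ℝ) + 1) * ((q + 1) * q ^ I n + (q + 1) * q ^ J n) + 2 * (q + 1) ^ 2)) /
      ((q + 1) * n)) atTop (𝓝 0) := by
  -- The numerator is at most A√n + B: A collects the coefficients of √n and B the constants.
  set A : ℝ := ((q : ℝ) + 1) * C * (4 * ((q : ℝ) + 1) ^ 4 * C ^ 2) * 2 +
    l * (((q : ℝ) + 1) * C * 2) + ((l : ℝ) + 1) * (4 * ((q : ℝ) + 1) ^ 2 * C)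
  set B : ℝ := l * ((q : ℝ) + 1) ^ 2 + ((q : ℝ) + 1) ^ 3 * (q + 2) * C ^ 2 +
    ((l : ℝ) + 1) * (2 * (q + 1) ^ 2)
  have hlim := ((tendsto_const_div_sqrt A).add
    (tendsto_const_div_atTop_nhds_zero_nat B)).const_mul (1 / ((q : ℝ) + 1))
  rw [add_zero, mul_zero] at hlim
  refine squeeze_zero' (Eventually.of_forall fun n => ?_) ?_ hlim
  · unfold linkError deficitBound
    positivity
  · filter_upwards [hI, hJ, eventually_gt_atTop 0] with n n1 n2 n3
    have hn : (0 : ℝ) < n := by exact_mod_cast n3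
    have hs : 0 < √(n : ℝ) := Real.sqrt_pos.2 hn
    have hss : √(n : ℝ) * √n = n := Real.mul_self_sqrt hn.le
    have d1 := deficitBound_le n3 n1
    have d2 := deficitBound_le n3 n2
    have d0 : ∀ i, 0 ≤ deficitBound q n i := fun i => by unfold deficitBound; positivity
    have e1 : ((q : ℝ) + 1) * q ^ J n * deficitBound q n (I n) ≤
        ((q : ℝ) + 1) * (C * √n) * (4 * ((q : ℝ) + 1) ^ 4 * C ^ 2) := by
      gcongr
      exact d0 _
    have e2 : ((q : ℝ) + 1) * q ^ I n * deficitBound q n (J n) ≤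
        ((q : ℝ) + 1) * (C * √n) * (4 * ((q : ℝ) + 1) ^ 4 * C ^ 2) := by
      gcongr
      exact d0 _
    have e3 : ((l : ℝ) * (((q : ℝ) + 1) * q ^ I n + (q + 1) * q ^ J n + (q + 1) ^ 2)) ≤
        l * ((q + 1) * (C * √n) + (q + 1) * (C * √n) + (q + 1) ^ 2) := by gcongr
    have e4 : ((q : ℝ) + 1) ^ 3 * (q + 2) * q ^ (I n + J n) / n ≤
        ((q : ℝ) + 1) ^ 3 * (q + 2) * C ^ 2 := by
      rw [div_le_iff₀ hn, pow_add]
      calc _ ≤ ((q : ℝ) + 1) ^ 3 * (q + 2) * ((C * √n) * (C * √n)) := by gcongr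
        _ = ((q : ℝ) + 1) ^ 3 * (q + 2) * C ^ 2 * (√n * √n) := by ring
        _ = _ := by rw [hss]
    have e5 : ((l : ℝ) + 1) *
        (2 * ((q : ℝ) + 1) * ((q + 1) * q ^ I n + (q + 1) * q ^ J n) + 2 * (q + 1) ^ 2) ≤
        ((l : ℝ) + 1) * (2 * ((q : ℝ) + 1) * ((q + 1) * (C * √n) + (q + 1) * (C * √n)) +
          2 * (q + 1) ^ 2) := by gcongr
    have e6 : 1 / ((q : ℝ) + 1) * (A / √n + B / n) = (A * √n + B) / ((q + 1) * n) := by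
      have : A / √n = A * √n / n := by
        rw [div_eq_div_iff hs.ne' hn.ne', mul_assoc, hss]
      rw [this]
      field_simp
    rw [e6]
    refine div_le_div_of_nonneg_right ?_ (by positivity)
    rw [linkError]
    simp only [A, B]
    linarith

lemma tendsto_multi_error {q : ℕ} {I J : ℕ → ℕ} {C : ℝ} (hC : 0 ≤ C)
    (hI : ∀ᶠ n in atTop, (q : ℝ) ^ I n ≤ C * √(n : ℝ))
    (hJ : ∀ᶠ n in atTop, (q : ℝ) ^ J n ≤ C * √(n : ℝ)) :
    Tendsto (fun n : ℕ => ((q : ℝ) + 1) * q ^ J n * deficitBound q n (I n) / n +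
      ((q : ℝ) + 1) * q ^ I n * deficitBound q n (J n) / n) atTop (𝓝 0) := by
  have hlim := tendsto_const_div_sqrt (2 * (((q : ℝ) + 1) * C * (4 * ((q : ℝ) + 1) ^ 4 * C ^ 2)))
  refine squeeze_zero' (Eventually.of_forall fun n => ?_) ?_ hlim
  · unfold deficitBound
    positivity
  · filter_upwards [hI, hJ, eventually_gt_atTop 0] with n n1 n2 n3
    have hn : (0 : ℝ) < n := by exact_mod_cast n3
    have hs : 0 < √(n : ℝ) := Real.sqrt_pos.2 hn
    have hss : √(n : ℝ) * √n = n := Real.mul_self_sqrt hn.le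
    have d1 := deficitBound_le n3 n1
    have d2 := deficitBound_le n3 n2
    have d0 : ∀ i, 0 ≤ deficitBound q n i := fun i => by unfold deficitBound; positivity
    have e1 : ((q : ℝ) + 1) * q ^ J n * deficitBound q n (I n) ≤
        ((q : ℝ) + 1) * (C * √n) * (4 * ((q : ℝ) + 1) ^ 4 * C ^ 2) := by
      gcongr
      exact d0 _
    have e2 : ((q : ℝ) + 1) * q ^ I n * deficitBound q n (J n) ≤
        ((q : ℝ) + 1) * (C * √n) * (4 * ((q : ℝ) + 1) ^ 4 * C ^ 2) := by
      gcongr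
      exact d0 _
    have e : 2 * (((q : ℝ) + 1) * C * (4 * ((q : ℝ) + 1) ^ 4 * C ^ 2)) / √n =
        2 * (((q : ℝ) + 1) * (C * √n) * (4 * ((q : ℝ) + 1) ^ 4 * C ^ 2)) / n := by
      rw [div_eq_div_iff hs.ne' hn.ne']
      linear_combination -(2 * (((q : ℝ) + 1) * C * (4 * ((q : ℝ) + 1) ^ 4 * C ^ 2))) * hss
    rw [e, ← add_div]
    gcongr
    linarith

/-- The integer part of half of `log_q n`. -/
noncomputable def level (q n : ℕ) : ℤ := ⌊(1 / 2 : ℝ) * Real.logb q n⌋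

/-- The normalising factor of the mean number of paths. -/
noncomputable def scale (q n : ℕ) : ℝ :=
  ((q : ℝ) + 1) * (q : ℝ) ^ (-1 - 2 * gammaFrac n (q + 1))

lemma gammaFrac_add_level (q n : ℕ) :
    (level q n : ℝ) + gammaFrac n (q + 1) = (1 / 2 : ℝ) * Real.logb q n := by
  rw [level, gammaFrac, Nat.cast_add, Nat.cast_one, add_sub_cancel_right]
  exact Int.floor_add_fract _

lemma gammaFrac_nonneg (n d : ℕ) : 0 ≤ gammaFrac n d := Int.fract_nonneg _

lemma gammaFrac_lt_one (n d : ℕ) : gammaFrac n d < 1 := Int.fract_lt_one _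

lemma scale_le {q : ℕ} (hq : 2 ≤ q) (n : ℕ) : scale q n ≤ (q : ℝ) + 1 := by
  have hq' : (2 : ℝ) ≤ q := by exact_mod_cast hq
  refine mul_le_of_le_one_right (by positivity) ?_
  exact Real.rpow_le_one_of_one_le_of_nonpos (by linarith)
    (by linarith [gammaFrac_nonneg n (q + 1)])

/-- The exponent -1 - 2γ exceeds -3 because γ < 1. A uniform lower bound suffices; no convergence of
`scale` is needed. -/
lemma le_scale {q : ℕ} (hq : 2 ≤ q) (n : ℕ) :
    ((q : ℝ) + 1) * (q : ℝ) ^ (-3 : ℝ) ≤ scale q n := by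
  have hq' : (2 : ℝ) ≤ q := by exact_mod_cast hq
  unfold scale
  gcongr
  · linarith
  · linarith [gammaFrac_lt_one n (q + 1)]

lemma zpow_level {q n : ℕ} (hq : 2 ≤ q) (hn : 0 < n) :
    (q : ℝ) ^ (2 * level q n) = n * (q : ℝ) ^ (-(2 * gammaFrac n (q + 1))) := by
  have hq' : (2 : ℝ) ≤ q := by exact_mod_cast hq
  have hn' : (0 : ℝ) < n := by exact_mod_cast hn
  have h : (n : ℝ) = (q : ℝ) ^ (2 * (level q n : ℝ) + 2 * gammaFrac n (q + 1)) := by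
    rw [← mul_add, gammaFrac_add_level, ← mul_assoc]
    norm_num
    rw [Real.rpow_logb (by linarith) (by linarith) hn']
  rw [h, ← Real.rpow_add (by linarith), add_neg_cancel_right, ← Real.rpow_intCast]
  push_cast
  rfl

lemma zpow_level_le {q n : ℕ} (hq : 2 ≤ q) (hn : 0 < n) : (q : ℝ) ^ level q n ≤ √(n : ℝ) := by
  have hq' : (2 : ℝ) ≤ q := by exact_mod_cast hq
  apply Real.le_sqrt_of_sq_le
  rw [← zpow_natCast, ← zpow_mul, mul_comm, Nat.cast_ofNat, zpow_level hq hn]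
  refine mul_le_of_le_one_right (Nat.cast_nonneg n) ?_
  exact Real.rpow_le_one_of_one_le_of_nonpos (by linarith)
    (by linarith [gammaFrac_nonneg n (q + 1)])

lemma tendsto_level {q : ℕ} (hq : 2 ≤ q) : Tendsto (level q) atTop atTop := by
  have hq' : (1 : ℝ) < q := by exact_mod_cast hq
  exact tendsto_floor_atTop.comp (((Real.tendsto_logb_atTop hq').comp
    tendsto_natCast_atTop_atTop).const_mul_atTop (by norm_num))

/-- The radius of the first ball at offset `h`. -/
noncomputable def radius (q : ℕ) (h : ℤ) (n : ℕ) : ℕ := (level q n + h - 1).toNat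

/-- Once the level is at least 1 - h, the truncation in `toNat` is inactive. -/
lemma eventually_pow_radius {q : ℕ} (hq : 2 ≤ q) (h : ℤ) :
    ∀ᶠ n in atTop, 0 < n ∧ radius q (h + 1) n = radius q h n + 1 ∧
      (q : ℝ) ^ radius q h n = (q : ℝ) ^ (level q n + h - 1) := by
  filter_upwards [eventually_gt_atTop 0, (tendsto_level hq).eventually_ge_atTop (1 - h)]
    with n n1 n2
  refine ⟨n1, ?_, ?_⟩
  · unfold radius
    omega
  · rw [← zpow_natCast, radius, Int.toNat_of_nonneg (by omega)]

lemma eventually_pow_radius_le {q : ℕ} (hq : 2 ≤ q) (h : ℤ) :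
    ∀ᶠ n in atTop, (q : ℝ) ^ radius q h n ≤ (1 + (q : ℝ) ^ (h - 1)) * √(n : ℝ) := by
  have hq' : (2 : ℝ) ≤ q := by exact_mod_cast hq
  filter_upwards [eventually_pow_radius hq h] with n n1
  rw [n1.2.2, add_sub_assoc, zpow_add₀ (by linarith), mul_comm]
  gcongr
  · linarith
  · exact zpow_level_le hq n1.1

/-- The second radius is the level itself, so the radii add up to 2 · level + h - 1, and q^(2 ·
level) = n q^(-2γ). -/
lemma eventually_mean {q : ℕ} (hq : 2 ≤ q) (h : ℤ) :
    ∀ᶠ n : ℕ in atTop, ((q : ℝ) + 1) * q ^ (radius q h n + radius q 1 n) / n =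
      scale q n * (q : ℝ) ^ h := by
  have hq' : (2 : ℝ) ≤ q := by exact_mod_cast hq
  have hq0 : (0 : ℝ) < q := by linarith
  filter_upwards [eventually_pow_radius hq h, eventually_pow_radius hq 1] with n n1 n2
  have hn : (0 : ℝ) < n := by exact_mod_cast n1.1
  rw [pow_add, n1.2.2, n2.2.2, ← zpow_add₀ hq0.ne',
    show level q n + h - 1 + (level q n + 1 - 1) = 2 * level q n + (h - 1) by ring,
    zpow_add₀ hq0.ne', zpow_level hq n1.1, scale,
    show -1 - 2 * gammaFrac n (q + 1) = -1 + -(2 * gammaFrac n (q + 1)) by ring,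
    Real.rpow_add hq0, Real.rpow_neg_one, zpow_sub_one₀ hq0.ne']
  field_simp

lemma eventually_ball_small_radius {q : ℕ} (hq : 2 ≤ q) (h : ℤ) :
    ∀ᶠ n in atTop, 4 * ((q + 1) * q ^ radius q h n + (q + 1)) ≤ n :=
  eventually_ball_small (eventually_pow_radius_le hq h)

/-- If y is the mean at offset 2k - 1, then qy is the mean at offset 2k. Since q²y/(q - 1) = qy/(q -
1) + qy, the second weight is the first times q^l exp(-qy). -/
lemma geodesicTerm_eq {q : ℕ} (hq : 2 ≤ q) (l n : ℕ) :
    geodesicTerm (q + 1) l n = pairWeight q l (scale q n) := by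
  have hq' : (2 : ℝ) ≤ q := by exact_mod_cast hq
  have hq0 : (0 : ℝ) < q := by linarith
  have hq1 : (q : ℝ) - 1 ≠ 0 := by linarith
  ext k
  set γ := gammaFrac n (q + 1) with hγ
  set y : ℝ := scale q n * (q : ℝ) ^ (2 * k - 1) with hy
  have e0 : (q : ℝ) ^ (2 * (k : ℝ) - 2 * γ - 2) = (q : ℝ) ^ (-1 - 2 * γ) * (q : ℝ) ^ (2 * k - 1) := by
    rw [← Real.rpow_intCast, ← Real.rpow_add hq0]
    congr 1
    push_cast
    ring
  have e1 : ((q : ℝ) + 1) * (q : ℝ) ^ (2 * (k : ℝ) - 2 * γ - 2) = y := by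
    rw [e0, hy, scale, mul_assoc]
  have e2 : ((q : ℝ) + 1) * (q : ℝ) ^ (2 * (k : ℝ) - 2 * γ - 1) = q * y := by
    rw [← e1, show 2 * (k : ℝ) - 2 * γ - 1 = (2 * (k : ℝ) - 2 * γ - 2) + 1 by ring,
      Real.rpow_add_one hq0.ne']
    ring
  have e3 : scale q n * (q : ℝ) ^ (2 * k) = q * y := by
    rw [hy, zpow_sub_one₀ hq0.ne']
    field_simp
  have e4 : -((q : ℝ) * (q * y) / (q - 1)) = -(q * y / (q - 1)) + -(q * y) := by
    field_simp
    ring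
  rw [geodesicTerm, pairWeight, weight, weight, ← hy, e3]
  push_cast
  rw [add_sub_cancel_right, show ((q : ℝ) + 1) - 2 = q - 1 by ring, ← hγ, e1, e2, e4,
    Real.exp_add, mul_pow]
  ring

/-- The weight at offset 0 suffices, since its mean is `scale`, which stays in a fixed compact
subset of the positive reals. -/
lemma exists_pos_le_tsum {q l : ℕ} (hq : 2 ≤ q) (hl : 1 ≤ l) :
    ∃ c > 0, ∀ n, c ≤ ∑' k, pairWeight q l (scale q n) k := by
  have hq' : (2 : ℝ) ≤ q := by exact_mod_cast hq
  have hq0 : (0 : ℝ) < q := by linarith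
  have hq1 : (0 : ℝ) < q - 1 := by linarith
  set θ₀ : ℝ := ((q : ℝ) + 1) * (q : ℝ) ^ (-3 : ℝ)
  have h0 : 0 < θ₀ := by positivity
  refine ⟨θ₀ ^ l / l.factorial * Real.exp (-(q * (q + 1) / (q - 1))), by positivity, fun n => ?_⟩
  have h1 := le_scale hq n
  have h2 := scale_le hq n
  have hs : 0 < scale q n := h0.trans_le h1
  refine le_trans ?_ ((summable_pairWeight hq' hl hs).le_tsum 0 fun k _ =>
    pairWeight_nonneg hq' hs.le l k)
  refine le_trans ?_ (le_add_of_nonneg_left (weight_nonneg _ _ (by positivity)))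
  rw [weight, mul_zero, zpow_zero, mul_one]
  gcongr

lemma tendsto_prob_geodesics {q l : ℕ} (hq : 2 ≤ q) (hl : 1 ≤ l) :
    Tendsto (fun n : ℕ => prob (V := Fin n) (q + 1) (fun G u v => numGeodesics G u v = l) -
      ∑' k, pairWeight q l (scale q n) k) (atTop ⊓ 𝓟 {n : ℕ | Even ((q + 1) * n)}) (𝓝 0) := by
  have hq' : (2 : ℝ) ≤ q := by exact_mod_cast hq
  have hq0 : (0 : ℝ) < q := by linarith
  set F : Filter ℕ := atTop ⊓ 𝓟 {n : ℕ | Even ((q + 1) * n)} with hF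
  have hle : F ≤ atTop := inf_le_left
  have hne : ∀ᶠ n in F, 0 < n ∧ (regGraphs (Fin n) (q + 1)).Nonempty := by
    rw [hF, eventually_inf_principal]
    filter_upwards [eventually_ge_atTop (q + 1 + 1)] with n hn he
    exact ⟨by omega, regGraphs_nonempty hn he⟩
  have hC : ∀ h : ℤ, (0 : ℝ) ≤ (1 + (q : ℝ) ^ (h - 1)) + (1 + (q : ℝ) ^ ((1 : ℤ) - 1)) :=
    fun h => by positivity
  have hI : ∀ h : ℤ, ∀ᶠ n in atTop, (q : ℝ) ^ radius q h n ≤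
      ((1 + (q : ℝ) ^ (h - 1)) + (1 + (q : ℝ) ^ ((1 : ℤ) - 1))) * √(n : ℝ) := by
    intro h
    filter_upwards [eventually_pow_radius_le hq h] with n hn
    exact hn.trans (mul_le_mul_of_nonneg_right (le_add_of_nonneg_right (by positivity))
      (Real.sqrt_nonneg _))
  have hJ : ∀ h : ℤ, ∀ᶠ n in atTop, (q : ℝ) ^ radius q 1 n ≤
      ((1 + (q : ℝ) ^ (h - 1)) + (1 + (q : ℝ) ^ ((1 : ℤ) - 1))) * √(n : ℝ) := by
    intro h
    filter_upwards [eventually_pow_radius_le hq 1] with n hn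
    exact hn.trans (mul_le_mul_of_nonneg_right (le_add_of_nonneg_left (by positivity))
      (Real.sqrt_nonneg _))
  refine tendsto_sub_tsum_of_ratio hq' (θ := scale q) (θ₀ := ((q : ℝ) + 1) * (q : ℝ) ^ (-3 : ℝ))
    (θ₁ := (q : ℝ) + 1) (by positivity) (le_scale hq) (scale_le hq) hl
    (a := fun h l n => prob (V := Fin n) (q + 1) (Linked (radius q h n) (radius q 1 n) l))
    (p := fun h n => prob (V := Fin n) (q + 1) (Far (radius q h n) (radius q 1 n)))
    (g := fun h n => prob (V := Fin n) (q + 1) (fun G u v => numGeodesics G u v = l ∧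
      Far (radius q h n) (radius q 1 n) G u v)) ?_ ?_ ?_ ?_ ?_ ?_
  · intro h l
    refine squeeze_zero_norm' ?_
      ((tendsto_ratio_error (l := l) (hC h) (hI h) (hJ h)).mono_left hle)
    filter_upwards [hne, (eventually_mean hq h).filter_mono hle,
      (eventually_ball_small_radius hq h).filter_mono hle,
      (eventually_ball_small_radius hq 1).filter_mono hle] with n n1 n2 n3 n4
    have : Nonempty (Fin n) := ⟨⟨0, n1.1⟩⟩
    have := abs_linked_ratio_le hq n1.2 (radius q h n) (radius q 1 n) l
      (by rwa [Fintype.card_fin]) (by rwa [Fintype.card_fin])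
    rw [Fintype.card_fin, n2] at this
    exact this
  · intro h
    filter_upwards [hne, (eventually_pow_radius hq h).filter_mono hle] with n n1 n2
    have : Nonempty (Fin n) := ⟨⟨0, n1.1⟩⟩
    rw [n2.2.1, prob_linked_zero]
  · intro h
    -- One factor q + 1 is left over from the Markov bound; the other bounds `scale`.
    refine ⟨((q : ℝ) + 1) * ((q + 1) * (q : ℝ) ^ h), fun K hK => ?_⟩
    filter_upwards [hne, (eventually_mean hq h).filter_mono hle] with n n1 n2
    have : Nonempty (Fin n) := ⟨⟨0, n1.1⟩⟩
    have h1 := prob_far_card_ge_le hq n1.2 (radius q h n) (radius q 1 n) hK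
    rw [prob_far_eq_sum (V := Fin n) _ _ _ K, add_sub_cancel_left, abs_of_nonneg (prob_nonneg _ _)]
    refine h1.trans ?_
    gcongr
    rw [Fintype.card_fin, sq, mul_assoc, mul_div_assoc, n2]
    gcongr
    exact scale_le hq n
  · intro h
    filter_upwards [hne, (eventually_mean hq h).filter_mono hle] with n n1 n2
    have : Nonempty (Fin n) := ⟨⟨0, n1.1⟩⟩
    have h1 := prob_not_far_le hq n1.2 (radius q h n) (radius q 1 n)
    have h2 := prob_add_prob_not n1.2 (Far (radius q h n) (radius q 1 n))
    rw [Fintype.card_fin, n2] at h1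
    exact ⟨by linarith, prob_le_one n1.2 _⟩
  · intro h
    refine squeeze_zero_norm' ?_ ((tendsto_multi_error (hC h) (hI h) (hJ h)).mono_left hle)
    filter_upwards [hne, (eventually_pow_radius hq h).filter_mono hle,
      (eventually_ball_small_radius hq h).filter_mono hle,
      (eventually_ball_small_radius hq 1).filter_mono hle] with n n1 n2 n3 n4
    have : Nonempty (Fin n) := ⟨⟨0, n1.1⟩⟩
    have h1 := abs_geodesics_step_le (V := Fin n) (q + 1) (radius q h n) (radius q 1 n) hl
    have h2 := prob_walkCount_ne_le hq n1.2 (radius q h n) (radius q 1 n)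
      (by rwa [Fintype.card_fin]) (by rwa [Fintype.card_fin])
    rw [Fintype.card_fin] at h2
    rw [n2.2.1]
    exact h1.trans h2
  · intro h
    filter_upwards [hne] with n n1
    have : Nonempty (Fin n) := ⟨⟨0, n1.1⟩⟩
    refine ⟨prob_nonneg _ _, prob_mono fun _ _ _ _ h => h.2, ?_⟩
    have h1 : prob (V := Fin n) (q + 1) (fun G u v => numGeodesics G u v = l ∧
      Far (radius q h n) (radius q 1 n) G u v) ≤
      prob (V := Fin n) (q + 1) (fun G u v => numGeodesics G u v = l) :=
      prob_mono fun _ _ _ _ h => h.1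
    have h2 : prob (V := Fin n) (q + 1) (fun G u v => numGeodesics G u v = l) ≤
      prob (V := Fin n) (q + 1) (fun G u v => numGeodesics G u v = l ∧
      Far (radius q h n) (radius q 1 n) G u v) +
      prob (V := Fin n) (q + 1) (fun G u v => ¬ Far (radius q h n) (radius q 1 n) G u v) :=
      prob_le_add fun _ _ _ _ h => by tauto
    have h3 := prob_add_prob_not n1.2 (Far (radius q h n) (radius q 1 n))
    rw [abs_of_nonneg (by linarith)]
    linarith

end
end RandomRegular

theorem theorem2p6 (d : ℕ) (hd : 3 ≤ d) (l : ℕ) (hl : 1 ≤ l) :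
    (∀ n : ℕ, Summable (geodesicTerm d l n)) ∧
      (fun n : ℕ => randomRegularProb n d (fun G u v => numGeodesics G u v = l))
        ~[atTop ⊓ 𝓟 {n : ℕ | Even (d * n)}]
        (fun n : ℕ => ∑' k : ℤ, geodesicTerm d l n k) := by
  obtain ⟨q, rfl⟩ : ∃ q, d = q + 1 := ⟨d - 1, by omega⟩
  have hq : 2 ≤ q := by omega
  have hq' : (2 : ℝ) ≤ q := by exact_mod_cast hq
  refine ⟨fun n => ?_, ?_⟩
  · rw [RandomRegular.geodesicTerm_eq hq]
    refine RandomRegular.summable_pairWeight hq' hl (lt_of_lt_of_le ?_ (RandomRegular.le_scale hq n))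
    positivity
  · simp only [RandomRegular.randomRegularProb_eq, RandomRegular.geodesicTerm_eq hq]
    obtain ⟨c, hc, hle⟩ := RandomRegular.exists_pos_le_tsum hq hl
    have h := (isLittleO_one_iff ℝ).2 (RandomRegular.tendsto_prob_geodesics hq hl)
    -- The difference is o(1) and the series is at least c > 0, so the difference is negligible
    -- relative to the series.
    refine h.trans_isBigO (IsBigO.of_bound (1 / c) (Eventually.of_forall fun n => ?_))
    rw [norm_one, Real.norm_eq_abs, div_mul_eq_mul_div, one_mul, le_div_iff₀ hc, one_mul]
    exact (hle n).trans (le_abs_self _)
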